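/- Let $n,m\ge 1$ be integers. A cube is a cube in $\mathbb R^n$ with sides parallel to the coordinate axes and positive side length, and $\frac1{|Q|}\int_Q$ denotes the average over $Q$ with respect to Lebesgue measure. A weight is a measurable function on $\mathbb R^n$ with values in $(0,\infty)$ almost everywhere. Let $\vec w=(w_1,\dots,w_m)$ be an $m$-tuple of weights, put $\nu=\prod_{i=1}^m w_i^{1/m}$, and suppose that $\vec w\in A_{\vec 1}$, i.e. $$\sup_Q\Big(\frac1{|Q|}\int_Q\nu\Big)^{m}\prod_{i=1}^m\big(\operatorname*{ess\,inf}_Q w_i\big)^{-1}<\infty .$$ Let $v$ be a weight such that $\nu v^{1/m}\in A_\infty=\bigcup_{1<p<\infty}A_p$, where a weight $u$ is in $A_p$ if $\sup_Q\big(\frac1{|Q|}\int_Q u\big)\big(\frac1{|Q|}\int_Q u^{-1/(p-1)}\big)^{p-1}<\infty$ (all suprema are over all cubes $Q$). Then there is a finite constant $C$ such that for all measurable functions $f_1,\dots,f_m:\mathbb R^n\to\mathbb C$, $$\Big\|\frac{\mathcal M(\vec f\,)}{v}\Big\|_{L^{1/m,\infty}(\nu v^{1/m})}\le C\prod_{i=1}^m\|f_i\|_{L^1(w_i)},$$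 where $$\mathcal M(\vec f\,)(x)=\sup_{Q\ni x}\prod_{i=1}^m\frac1{|Q|}\int_Q|f_i(y)|\,dy,\qquad \|f_i\|_{L^1(w_i)}=\int_{\mathbb R^n}|f_i|\,w_i\,dx,$$ $$\|g\|_{L^{1/m,\infty}(\nu v^{1/m})}=\sup_{t>0}\,t\,\Big(\int_{\{x:\,|g(x)|>t\}}\nu(x)\,v(x)^{1/m}\,dx\Big)^{m},$$ and $0\cdot\infty=0$ in products. -/

import Mathlib

/-!
On a dyadic grid, `ν` is an `A₁` weight, because
`(⨍_Q ν)^m ≤ C ∏ᵢ ess inf_Q wᵢ ≤ C (ess inf_Q ν)^m`; hence `ν` satisfies a reverse Hölder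
inequality. Put `r = ν v^{1/m}`. Hölder's inequality combines the reverse Hölder inequality of `ν`
with the `A_q` condition of `r` into a reverse Hölder inequality for `ν / r` with respect to the
measure `r dx`. This self-improvement gives the scalar mixed weak type estimate
`‖(ν / r) M_ν h‖_{L^{1,∞}(r)} ≤ K ∫ h ν`, where `M_ν` is the dyadic maximal function of the measure
`ν dx`.

The multilinear condition bounds `∏ᵢ ⨍_Q fᵢ` by `C ∏ᵢ ⨍_Q (fᵢ wᵢ / ν) d(ν dx)`, and
`v⁻¹ = (ν / r)^m`. Since every cube lies in a cube of comparable size of one of `2ⁿ` shifted dyadic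
grids, `𝓜(f) / v` is thus at most a constant times the maximum over these grids of
`∏ᵢ (ν / r) M_ν(fᵢ wᵢ / ν)`, and the multilinear estimate follows from Hölder's inequality for weak
Lebesgue spaces.
-/

open MeasureTheory Filter
open scoped ENNReal NNReal

noncomputable section

namespace MixedWeak

/-- The closed cube in `ℝⁿ` with sides parallel to the axes, lower corner `a` and side length `l`
(it is a genuine cube when `0 < l`). -/
def cube {n : ℕ} (a : Fin n → ℝ) (l : ℝ) : Set (Fin n → ℝ) :=
  Set.Icc a (fun j => a j + l)

/-- The average `(1 / |Q|) ∫_Q g` of a function with values in `[0, ∞]` over the cube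
`Q = cube a l`, with respect to Lebesgue measure. -/
def avg {n : ℕ} (a : Fin n → ℝ) (l : ℝ) (g : (Fin n → ℝ) → ℝ≥0∞) : ℝ≥0∞ :=
  (volume (cube a l))⁻¹ * ∫⁻ x in cube a l, g x

/-- A weight on `ℝⁿ`: a Lebesgue measurable function with values in `[0, ∞]` such that
`0 < w < ∞` almost everywhere. Local integrability is not part of the definition: it is implied
by each scalar Muckenhoupt condition, but the components of a vector weight
satisfying the multilinear `A_1` condition need not be locally integrable. -/
structure IsWeight {n : ℕ} (w : (Fin n → ℝ) → ℝ≥0∞) : Prop where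
  aemeasurable : AEMeasurable w volume
  pos : ∀ᵐ x ∂(volume : Measure (Fin n → ℝ)), 0 < w x
  lt_top : ∀ᵐ x ∂(volume : Measure (Fin n → ℝ)), w x < ∞

/-- The Muckenhoupt class `A_p` for `1 < p < ∞` (note `1 - p' = -1 / (p - 1)`):
the supremum over all cubes `Q` of `(⨍_Q w) (⨍_Q w^{1 - p'})^{p - 1}` is finite. -/
def MemAp {n : ℕ} (p : ℝ) (w : (Fin n → ℝ) → ℝ≥0∞) : Prop :=
  IsWeight w ∧ ∃ C : ℝ≥0, ∀ (a : Fin n → ℝ) (l : ℝ), 0 < l →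
    avg a l w * avg a l (fun x => w x ^ (-1 / (p - 1))) ^ (p - 1) ≤ C

/-- The class `A_∞`, the union of the classes `A_p`, `1 < p < ∞`. -/
def MemAInfty {n : ℕ} (w : (Fin n → ℝ) → ℝ≥0∞) : Prop :=
  ∃ p : ℝ, 1 < p ∧ MemAp p w

/-- `ν = w₁^{1/m} ⋯ w_m^{1/m}`. -/
def nu {n m : ℕ} (w : Fin m → (Fin n → ℝ) → ℝ≥0∞) (x : Fin n → ℝ) : ℝ≥0∞ :=
  ∏ i, w i x ^ (1 / (m : ℝ))

/-- The multilinear condition `A_{(1, …, 1)}`: the `w_i` are weights, and the supremum over all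
cubes `Q` of `(⨍_Q ν)^m ∏_i (ess inf_Q w_i)⁻¹` is finite. -/
def MemAOneVec {n m : ℕ} (w : Fin m → (Fin n → ℝ) → ℝ≥0∞) : Prop :=
  (∀ i, IsWeight (w i)) ∧ ∃ C : ℝ≥0, ∀ (a : Fin n → ℝ) (l : ℝ), 0 < l →
    avg a l (nu w) ^ m *
      ∏ i, (essInf (w i) (volume.restrict (cube a l)))⁻¹ ≤ C

/-- The multi(sub)linear maximal function
`𝓜(f₁, …, f_m)(x) = sup_{Q ∋ x} ∏_i (1 / |Q|) ∫_Q |f_i|`, the supremum being over all cubes `Q`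
containing `x`. -/
def multiMaximal {n m : ℕ} (f : Fin m → (Fin n → ℝ) → ℂ) (x : Fin n → ℝ) : ℝ≥0∞ :=
  ⨆ (a : Fin n → ℝ) (l : ℝ) (_ : 0 < l) (_ : x ∈ cube a l),
    ∏ i, avg a l (fun y => ‖f i y‖ₑ)

/-- The weak Lebesgue (quasi)norm `‖g‖_{L^{p,∞}(μ)} = sup_{t > 0} t μ({g > t})^{1/p}` of a
function with values in `[0, ∞]`. -/
def weakNorm {X : Type*} [MeasurableSpace X] (p : ℝ) (μ : Measure X) (g : X → ℝ≥0∞) : ℝ≥0∞ :=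
  ⨆ (t : ℝ≥0) (_ : 0 < t), (t : ℝ≥0∞) * μ {x | (t : ℝ≥0∞) < g x} ^ (1 / p)

end MixedWeak

end

noncomputable section

namespace MixedWeak

section WeakNorm

variable {X ι : Type*} [MeasurableSpace X] {μ : Measure X} {p : ℝ} {g h : X → ℝ≥0∞}

theorem mul_measure_rpow_le_weakNorm (p : ℝ) (μ : Measure X) (g : X → ℝ≥0∞) {t : ℝ≥0∞}
    (ht : t ≠ ∞) : t * μ {x | t < g x} ^ (1 / p) ≤ weakNorm p μ g := by
  lift t to ℝ≥0 using ht
  obtain rfl | ht := eq_zero_or_pos t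
  · simp
  · exact le_iSup₂_of_le t ht le_rfl

theorem weakNorm_mono_ae (hp : 0 ≤ p) (hgh : g ≤ᵐ[μ] h) : weakNorm p μ g ≤ weakNorm p μ h :=
  iSup₂_mono fun _ _ => by
    gcongr _ * ?_ ^ _
    exact measure_mono_ae (hgh.mono fun _ hx hlt => lt_of_lt_of_le hlt hx)

theorem weakNorm_zero (hp : 0 < p) : weakNorm p μ (fun _ => 0) = 0 := by
  simp [weakNorm, hp]

theorem ae_eq_zero_of_weakNorm_eq_zero (hp : 0 < p) (hg : weakNorm p μ g = 0) : g =ᵐ[μ] 0 := by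
  have hnull (k : ℕ) : μ {x | (k : ℝ≥0∞)⁻¹ < g x} = 0 := by
    obtain rfl | hk := eq_or_ne k 0
    · simp
    have hle := mul_measure_rpow_le_weakNorm p μ g (t := (k : ℝ≥0∞)⁻¹) (by simpa using hk)
    rw [hg, nonpos_iff_eq_zero, mul_eq_zero, ENNReal.rpow_eq_zero_iff_of_pos (by positivity)] at hle
    exact hle.resolve_left (by simp)
  refine measure_mono_null (fun x hx => ?_) (measure_iUnion_null hnull)
  exact Set.mem_iUnion.2 (ENNReal.exists_inv_nat_lt (show g x ≠ 0 from hx))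

theorem weakNorm_const_mul_le (hp : 0 < p) {c : ℝ≥0∞} (hc : c ≠ ∞) (g : X → ℝ≥0∞) :
    weakNorm p μ (fun x => c * g x) ≤ c * weakNorm p μ g := by
  obtain rfl | hc₀ := eq_or_ne c 0
  · simp [weakNorm_zero hp]
  refine iSup₂_le fun t _ => ?_
  have hset : {x | (t : ℝ≥0∞) < c * g x} = {x | (t : ℝ≥0∞) / c < g x} := by
    ext x
    rw [Set.mem_ofPred_eq, Set.mem_ofPred_eq, ENNReal.div_lt_iff (.inl hc₀) (.inl hc), mul_comm]
  calc (t : ℝ≥0∞) * μ {x | (t : ℝ≥0∞) < c * g x} ^ (1 / p)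
      = c * (t / c * μ {x | (t : ℝ≥0∞) / c < g x} ^ (1 / p)) := by
        rw [hset, ← mul_assoc, ENNReal.mul_div_cancel hc₀ hc]
    _ ≤ c * weakNorm p μ g := by
        gcongr
        exact mul_measure_rpow_le_weakNorm p μ g (ENNReal.div_ne_top ENNReal.coe_ne_top hc₀)

theorem weakNorm_iSup_le [Fintype ι] (hp : 0 < p) {f : ι → X → ℝ≥0∞} {C : ℝ≥0∞}
    (hf : ∀ i, weakNorm p μ (f i) ≤ C) :
    weakNorm p μ (fun x => ⨆ i, f i x) ≤ Fintype.card ι ^ (1 / p) * C := by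
  refine iSup₂_le fun t ht => ?_
  have ht₀ : (t : ℝ≥0∞) ≠ 0 := by exact_mod_cast ht.ne'
  have hlevel (i : ι) : μ {x | (t : ℝ≥0∞) < f i x} ≤ (C / t) ^ p := by
    rw [← ENNReal.rpow_inv_le_iff hp, ← one_div,
      ENNReal.le_div_iff_mul_le (.inl ht₀) (.inl ENNReal.coe_ne_top), mul_comm]
    exact (mul_measure_rpow_le_weakNorm p μ _ ENNReal.coe_ne_top).trans (hf i)
  have hunion : μ {x | (t : ℝ≥0∞) < ⨆ i, f i x} ≤ Fintype.card ι * (C / t) ^ p := by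
    simp only [lt_iSup_iff, Set.ofPred_exists]
    refine (measure_iUnion_fintype_le μ _).trans ((Finset.sum_le_sum fun i _ => hlevel i).trans ?_)
    simp
  calc (t : ℝ≥0∞) * μ {x | (t : ℝ≥0∞) < ⨆ i, f i x} ^ (1 / p)
      ≤ t * (Fintype.card ι * (C / t) ^ p) ^ (1 / p) := by gcongr
    _ = Fintype.card ι ^ (1 / p) * (t * (C / t)) := by
        rw [ENNReal.mul_rpow_of_nonneg _ _ (by positivity), ← ENNReal.rpow_mul,
          mul_one_div_cancel hp.ne', ENNReal.rpow_one]
        ring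
    _ ≤ Fintype.card ι ^ (1 / p) * C := by gcongr; exact ENNReal.mul_div_le

theorem measure_mul_weakNorm_lt_le (hzero : weakNorm 1 μ g ≠ 0) (htop : weakNorm 1 μ g ≠ ∞)
    {θ : ℝ≥0∞} (hθ : θ ≠ ∞) : μ {x | θ * weakNorm 1 μ g < g x} ≤ θ⁻¹ := by
  have hle := mul_measure_rpow_le_weakNorm 1 μ g (ENNReal.mul_ne_top hθ htop)
  rw [div_one, ENNReal.rpow_one] at hle
  rw [ENNReal.le_inv_iff_mul_le, ← ENNReal.mul_le_mul_iff_right hzero htop, mul_one]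
  exact le_of_eq_of_le (by ring) hle

theorem measure_lt_prod_le_sum [Fintype ι] (f : ι → X → ℝ≥0∞) {t : ℝ≥0∞} {τ : ι → ℝ≥0∞}
    (hτ : ∏ i, τ i ≤ t) : μ {x | t < ∏ i, f i x} ≤ ∑ i, μ {x | τ i < f i x} := by
  refine (measure_mono fun x hx => ?_).trans (measure_iUnion_fintype_le μ _)
  by_contra hnot
  simp only [Set.mem_iUnion, Set.mem_ofPred_eq, not_exists, not_lt] at hx hnot
  exact hx.not_ge ((Finset.prod_le_prod' fun i _ => hnot i).trans hτ)

theorem weakNorm_prod_le_of_ne_zero_of_ne_top [Fintype ι] [Nonempty ι] (f : ι → X → ℝ≥0∞)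
    (hzero : ∀ i, weakNorm 1 μ (f i) ≠ 0) (htop : ∀ i, weakNorm 1 μ (f i) ≠ ∞) :
    weakNorm (1 / Fintype.card ι) μ (fun x => ∏ i, f i x) ≤
      Fintype.card ι ^ Fintype.card ι * ∏ i, weakNorm 1 μ (f i) := by
  set m := Fintype.card ι
  set I := ∏ i, weakNorm 1 μ (f i)
  have hm : (m : ℝ) ≠ 0 := by simp [m]
  have hI₀ : I ≠ 0 := Finset.prod_ne_zero_iff.2 fun i _ => hzero i
  have hI : I ≠ ∞ := ENNReal.prod_ne_top fun i _ => htop i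
  refine iSup₂_le fun t ht => ?_
  set θ : ℝ≥0∞ := (t / I) ^ (1 / m : ℝ) with hθ
  have hθpow : θ ^ m = t / I := by
    rw [hθ, ← ENNReal.rpow_mul_natCast, one_div_mul_cancel hm, ENNReal.rpow_one]
  have hθtop : θ ≠ ∞ :=
    ENNReal.rpow_ne_top_of_nonneg (by positivity) (ENNReal.div_ne_top ENNReal.coe_ne_top hI₀)
  have hprod : ∏ i, θ * weakNorm 1 μ (f i) = t := by
    rw [Finset.prod_mul_distrib, Finset.prod_const, Finset.card_univ, hθpow,
      ENNReal.div_mul_cancel hI₀ hI]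
  have hmeas : μ {x | (t : ℝ≥0∞) < ∏ i, f i x} ≤ m * θ⁻¹ :=
    calc _ ≤ ∑ i, μ {x | θ * weakNorm 1 μ (f i) < f i x} := measure_lt_prod_le_sum f hprod.le
      _ ≤ ∑ _i : ι, θ⁻¹ := Finset.sum_le_sum fun i _ =>
          measure_mul_weakNorm_lt_le (hzero i) (htop i) hθtop
      _ = m * θ⁻¹ := by simp [m]
  calc (t : ℝ≥0∞) * μ {x | (t : ℝ≥0∞) < ∏ i, f i x} ^ (1 / (1 / m : ℝ))
      ≤ t * (m * θ⁻¹) ^ m := by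
        rw [one_div_one_div, ENNReal.rpow_natCast]
        gcongr
    _ = m ^ m * (t * (t / I)⁻¹) := by
        rw [mul_pow, ← ENNReal.inv_pow, hθpow]; ring
    _ = m ^ m * I := by
        rw [ENNReal.inv_div (.inl hI) (.inl hI₀), ENNReal.mul_div_cancel (by simp [ht.ne'])
          ENNReal.coe_ne_top]

/-- The convention `0 * ∞ = 0` on the right-hand side is honest: a factor with vanishing weak norm
vanishes almost everywhere. -/
theorem weakNorm_prod_le [Fintype ι] [Nonempty ι] (f : ι → X → ℝ≥0∞) :
    weakNorm (1 / Fintype.card ι) μ (fun x => ∏ i, f i x) ≤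
      Fintype.card ι ^ Fintype.card ι * ∏ i, weakNorm 1 μ (f i) := by
  by_cases hzero : ∃ i, weakNorm 1 μ (f i) = 0
  · obtain ⟨i, hi⟩ := hzero
    have hprod : (fun x => ∏ i, f i x) ≤ᵐ[μ] fun _ => 0 := by
      filter_upwards [ae_eq_zero_of_weakNorm_eq_zero one_pos hi] with x hx
      exact (Finset.prod_eq_zero (Finset.mem_univ i) hx).le
    refine (weakNorm_mono_ae (by positivity) hprod).trans ?_
    rw [weakNorm_zero (by positivity)]
    exact zero_le
  push Not at hzero
  by_cases htop : ∃ i, weakNorm 1 μ (f i) = ∞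
  · obtain ⟨i, hi⟩ := htop
    have hprod : ∏ i, weakNorm 1 μ (f i) = ∞ := by
      classical
      rw [← Finset.mul_prod_erase _ _ (Finset.mem_univ i), hi]
      exact ENNReal.top_mul (Finset.prod_ne_zero_iff.2 fun j _ => hzero j)
    simp [hprod]
  · push Not at htop
    exact weakNorm_prod_le_of_ne_zero_of_ne_top f hzero htop

end WeakNorm

section LayerCake

variable {X : Type*} [MeasurableSpace X] {μ : Measure X} {f : X → ℝ≥0∞} {p : ℝ}

theorem lintegral_rpow_eq_lintegral_measure_lt (hf : AEMeasurable f μ) (hp : 0 < p) :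
    ∫⁻ x, f x ^ p ∂μ = ENNReal.ofReal p * ∫⁻ s in Set.Ioi (0 : ℝ),
      μ {x | ENNReal.ofReal s < f x} * ENNReal.ofReal (s ^ (p - 1)) := by
  by_cases hfin : μ {x | f x = ∞} = 0
  · have hlt : ∀ᵐ x ∂μ, f x ≠ ∞ := by simpa [ae_iff] using hfin
    have hcake := lintegral_rpow_eq_lintegral_meas_lt_mul μ
      (ae_of_all μ fun x => ENNReal.toReal_nonneg (a := f x)) hf.ennreal_toReal hp
    convert hcake using 1
    · refine lintegral_congr_ae ?_
      filter_upwards [hlt] with x hx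
      rw [← ENNReal.ofReal_rpow_of_nonneg ENNReal.toReal_nonneg hp.le, ENNReal.ofReal_toReal hx]
    · congr 1
      refine setLIntegral_congr_fun measurableSet_Ioi fun s hs => ?_
      congr 1
      refine measure_congr ?_
      filter_upwards [hlt] with x hx
      exact propext (ENNReal.ofReal_lt_iff_lt_toReal (le_of_lt hs) hx)
  · have hpow : ∫⁻ s in Set.Ioi (0 : ℝ), ENNReal.ofReal (s ^ (p - 1)) = ∞ := by
      by_contra hne
      refine not_integrableOn_Ioi_rpow (p - 1) ⟨by fun_prop, ?_⟩
      refine (hasFiniteIntegral_iff_ofReal ?_).2 (lt_top_iff_ne_top.2 hne)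
      filter_upwards [ae_restrict_mem measurableSet_Ioi] with s hs
      exact Real.rpow_nonneg (le_of_lt hs) _
    have hright : ∞ ≤ ∫⁻ s in Set.Ioi (0 : ℝ),
        μ {x | ENNReal.ofReal s < f x} * ENNReal.ofReal (s ^ (p - 1)) :=
      calc ∞ = ∫⁻ s in Set.Ioi (0 : ℝ), μ {x | f x = ∞} * ENNReal.ofReal (s ^ (p - 1)) := by
            rw [lintegral_const_mul _ (by fun_prop), hpow, ENNReal.mul_top hfin]
        _ ≤ _ := by
            gcongr with s x hx
            exact fun h : f _ = ∞ => h ▸ ENNReal.ofReal_lt_top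
    rw [top_le_iff.1 hright, ENNReal.mul_top (by simpa using hp)]
    refine lintegral_eq_top_of_measure_eq_top_ne_zero (hf.pow_const p) ?_
    simpa [ENNReal.rpow_eq_top_iff_of_pos hp] using hfin

theorem lintegral_Ioo_rpow_sub_one (hp : 0 < p) (t : ℝ≥0) :
    ∫⁻ s in Set.Ioo (0 : ℝ) t, ENNReal.ofReal (s ^ (p - 1)) = t ^ p / ENNReal.ofReal p := by
  have hint : IntervalIntegrable (fun s : ℝ => s ^ (p - 1)) volume 0 t :=
    intervalIntegral.intervalIntegrable_rpow' (by linarith)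
  rw [restrict_Ioo_eq_restrict_Ioc, ← ofReal_integral_eq_lintegral_ofReal,
    ← intervalIntegral.integral_of_le t.coe_nonneg, integral_rpow (Or.inl (by linarith)),
    sub_add_cancel, Real.zero_rpow hp.ne', sub_zero, ENNReal.ofReal_div_of_pos hp,
    ← ENNReal.ofReal_rpow_of_nonneg t.coe_nonneg hp.le, ENNReal.ofReal_coe_nnreal]
  · exact (intervalIntegrable_iff_integrableOn_Ioc_of_le t.coe_nonneg).1 hint
  · filter_upwards [ae_restrict_mem measurableSet_Ioc] with s hs
    exact Real.rpow_nonneg hs.1.le _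

theorem measure_lt_mul_rpow_le_weakNorm (μ : Measure X) (f : X → ℝ≥0∞) (p : ℝ) {s : ℝ}
    (hs : 0 < s) : μ {x | ENNReal.ofReal s < f x} * ENNReal.ofReal (s ^ p) ≤
      ENNReal.ofReal (s ^ (p - 1)) * weakNorm 1 μ f := by
  have hweak := mul_measure_rpow_le_weakNorm 1 μ f (ENNReal.ofReal_ne_top (r := s))
  rw [div_one, ENNReal.rpow_one] at hweak
  have hpow : s ^ p = s ^ (p - 1) * s := by
    rw [Real.rpow_sub_one hs.ne', div_mul_cancel₀ _ hs.ne']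
  rw [hpow, ENNReal.ofReal_mul (by positivity), mul_left_comm, mul_comm (μ _)]
  gcongr

theorem lintegral_min_rpow_le_weakNorm (hf : AEMeasurable f μ) (hp : 1 < p) (t : ℝ≥0) :
    ∫⁻ x, min (f x) t ^ p ∂μ ≤
      ENNReal.ofReal p / ENNReal.ofReal (p - 1) * t ^ (p - 1) * weakNorm 1 μ f := by
  have hlevel (s : ℝ) (hs : s ∈ Set.Ioi 0) :
      μ {x | ENNReal.ofReal s < min (f x) t} * ENNReal.ofReal (s ^ (p - 1)) ≤
        (Set.Ioo 0 (t : ℝ)).indicator (fun s => ENNReal.ofReal (s ^ (p - 1 - 1))) s *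
          weakNorm 1 μ f := by
    by_cases hst : s < t
    · rw [Set.indicator_of_mem (show s ∈ Set.Ioo 0 (t : ℝ) from ⟨hs, hst⟩)]
      refine le_trans ?_ (measure_lt_mul_rpow_le_weakNorm μ f (p - 1) hs)
      gcongr
      exact min_le_left _ _
    · have hst' : ¬ ENNReal.ofReal s < t := by rwa [ENNReal.ofReal_lt_coe_iff (le_of_lt hs)]
      simp [hst']
  calc ∫⁻ x, min (f x) t ^ p ∂μ
      ≤ ENNReal.ofReal p * ∫⁻ s in Set.Ioi (0 : ℝ),
          (Set.Ioo 0 (t : ℝ)).indicator (fun s => ENNReal.ofReal (s ^ (p - 1 - 1))) s *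
            weakNorm 1 μ f := by
        rw [lintegral_rpow_eq_lintegral_measure_lt (hf.min aemeasurable_const) (by linarith)]
        gcongr ENNReal.ofReal p * ?_
        exact setLIntegral_mono' measurableSet_Ioi hlevel
    _ = _ := by
        rw [lintegral_mul_const _ (by measurability), setLIntegral_indicator measurableSet_Ioo,
          Set.inter_eq_left.2 Set.Ioo_subset_Ioi_self, lintegral_Ioo_rpow_sub_one (by linarith)]
        simp only [div_eq_mul_inv]
        ring

end LayerCake

section NestedFamily

variable {X : Type*}

theorem exists_pairwiseDisjoint_biUnion_eq (𝒯 : Finset (Set X))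
    (h𝒯 : ∀ Q ∈ 𝒯, ∀ R ∈ 𝒯, Disjoint Q R ∨ Q ⊆ R ∨ R ⊆ Q) :
    ∃ 𝒟 ⊆ 𝒯, (𝒟 : Set (Set X)).PairwiseDisjoint id ∧ ⋃ Q ∈ 𝒟, Q = ⋃ Q ∈ 𝒯, Q := by
  classical
  refine ⟨{Q ∈ 𝒯 | Maximal (· ∈ 𝒯) Q}, Finset.filter_subset _ _, fun Q hQ R hR hne => ?_, ?_⟩
  · obtain ⟨hQ, hQmax⟩ := Finset.mem_filter.1 hQ
    obtain ⟨hR, hRmax⟩ := Finset.mem_filter.1 hR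
    rcases h𝒯 Q hQ R hR with hdisj | hle | hle
    · exact hdisj
    · exact absurd (hQmax.eq_of_subset hR hle) hne
    · exact absurd (hRmax.eq_of_subset hQ hle).symm hne
  · refine subset_antisymm (Set.biUnion_subset_biUnion_left (Finset.filter_subset _ _)) ?_
    refine Set.iUnion₂_subset fun Q hQ => ?_
    obtain ⟨R, hQR, hR⟩ := 𝒯.exists_le_maximal hQ
    exact hQR.trans (Set.subset_biUnion_of_mem (u := id) (Finset.mem_filter.2 ⟨hR.prop, hR⟩))

variable [MeasurableSpace X]

/-- A countable family of measurable sets any two of which are disjoint or comparable, such as the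
cubes of a dyadic grid. -/
structure IsNestedFamily (𝒬 : Set (Set X)) : Prop where
  countable : 𝒬.Countable
  measurableSet : ∀ Q ∈ 𝒬, MeasurableSet Q
  disjoint_or_subset : ∀ Q ∈ 𝒬, ∀ R ∈ 𝒬, Disjoint Q R ∨ Q ⊆ R ∨ R ⊆ Q

/-- The maximal function of `g` with respect to the measure `μ` over the sets of the family `𝒬`;
it vanishes off their union. -/
def familyMaximal (𝒬 : Set (Set X)) (μ : Measure X) (g : X → ℝ≥0∞) (x : X) : ℝ≥0∞ :=
  ⨆ (Q ∈ 𝒬) (_ : x ∈ Q), ⨍⁻ y in Q, g y ∂μ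

variable {𝒬 : Set (Set X)} {μ : Measure X} {g h : X → ℝ≥0∞} {q : ℝ}

theorem lt_familyMaximal_iff {t : ℝ≥0∞} {x : X} :
    t < familyMaximal 𝒬 μ g x ↔ ∃ Q ∈ 𝒬, x ∈ Q ∧ t < ⨍⁻ y in Q, g y ∂μ := by
  simp only [familyMaximal, lt_iSup_iff, exists_prop]

theorem setLAverage_le_familyMaximal {Q : Set X} (hQ : Q ∈ 𝒬) {x : X} (hx : x ∈ Q) :
    ⨍⁻ y in Q, g y ∂μ ≤ familyMaximal 𝒬 μ g x :=
  le_iSup₂_of_le Q hQ (le_iSup_of_le hx le_rfl)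

theorem IsNestedFamily.measurable_familyMaximal (h𝒬 : IsNestedFamily 𝒬) (μ : Measure X)
    (g : X → ℝ≥0∞) : Measurable (familyMaximal 𝒬 μ g) := by
  refine Measurable.biSup 𝒬 h𝒬.countable fun Q hQ => ?_
  have hind : (fun x => ⨆ _ : x ∈ Q, ⨍⁻ y in Q, g y ∂μ) =
      Q.indicator fun _ => ⨍⁻ y in Q, g y ∂μ := by
    ext x
    by_cases hx : x ∈ Q <;> simp [hx]
  rw [hind]
  exact measurable_const.indicator (h𝒬.measurableSet Q hQ)

theorem familyMaximal_le_add {c : ℝ≥0∞} (hgh : ∀ x, g x ≤ h x + c) (x : X) :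
    familyMaximal 𝒬 μ g x ≤ familyMaximal 𝒬 μ h x + c := by
  refine iSup₂_le fun Q hQ => iSup_le fun hx => ?_
  calc ⨍⁻ y in Q, g y ∂μ ≤ ⨍⁻ y in Q, (h y + c) ∂μ := lintegral_mono fun y => hgh y
    _ = (⨍⁻ y in Q, h y ∂μ) + c * (μ Q / μ Q) := by
        simp only [setLAverage_eq, lintegral_add_right _ measurable_const, setLIntegral_const,
          ENNReal.add_div, mul_div_assoc]
    _ ≤ familyMaximal 𝒬 μ h x + c * 1 := by
        gcongr
        · exact setLAverage_le_familyMaximal hQ hx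
        · exact ENNReal.div_self_le_one
    _ = familyMaximal 𝒬 μ h x + c := by rw [mul_one]

theorem IsNestedFamily.mul_measure_biUnion_finset_le (h𝒬 : IsNestedFamily 𝒬) {t : ℝ≥0∞}
    (𝒯 : Finset (Set X)) (h𝒯 : ∀ Q ∈ 𝒯, Q ∈ 𝒬 ∧ t < ⨍⁻ y in Q, g y ∂μ) :
    t * μ (⋃ Q ∈ 𝒯, Q) ≤ ∫⁻ y, g y ∂μ := by
  have hmeas (Q : Set X) (hQ : Q ∈ 𝒯) : MeasurableSet Q := h𝒬.measurableSet Q (h𝒯 Q hQ).1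
  obtain ⟨𝒟, h𝒟𝒯, hdisj, hunion⟩ := exists_pairwiseDisjoint_biUnion_eq 𝒯 fun Q hQ R hR =>
    h𝒬.disjoint_or_subset Q (h𝒯 Q hQ).1 R (h𝒯 R hR).1
  rw [← hunion]
  calc t * μ (⋃ Q ∈ 𝒟, Q) = ∑ Q ∈ 𝒟, t * μ Q := by
        rw [← Finset.mul_sum]
        exact congrArg _ (measure_biUnion_finset hdisj fun Q hQ => hmeas Q (h𝒟𝒯 hQ))
    _ ≤ ∑ Q ∈ 𝒟, ∫⁻ y in Q, g y ∂μ := by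
        refine Finset.sum_le_sum fun Q hQ => ENNReal.mul_le_of_le_div ?_
        rw [← setLAverage_eq]
        exact (h𝒯 Q (h𝒟𝒯 hQ)).2.le
    _ = ∫⁻ y in ⋃ Q ∈ 𝒟, Q, g y ∂μ :=
        (lintegral_biUnion_finset hdisj (fun Q hQ => hmeas Q (h𝒟𝒯 hQ)) g).symm
    _ ≤ ∫⁻ y, g y ∂μ := setLIntegral_le_lintegral _ _

theorem IsNestedFamily.mul_measure_lt_familyMaximal_le (h𝒬 : IsNestedFamily 𝒬) (μ : Measure X)
    (g : X → ℝ≥0∞) (t : ℝ≥0∞) : t * μ {x | t < familyMaximal 𝒬 μ g x} ≤ ∫⁻ y, g y ∂μ := by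
  classical
  set 𝒯 : Set (Set X) := {Q | Q ∈ 𝒬 ∧ t < ⨍⁻ y in Q, g y ∂μ} with h𝒯
  have hset : {x | t < familyMaximal 𝒬 μ g x} = ⋃₀ 𝒯 := by
    ext x
    simp only [lt_familyMaximal_iff, h𝒯, Set.mem_ofPred_eq, Set.mem_sUnion]
    exact exists_congr fun Q => by tauto
  rw [hset]
  obtain hempty | hnonempty := 𝒯.eq_empty_or_nonempty
  · simp [hempty]
  obtain ⟨Q, hQ⟩ := (h𝒬.countable.mono fun Q hQ => hQ.1).exists_eq_range hnonempty
  rw [hQ, Set.sUnion_range, measure_iUnion_eq_iSup_accumulate, ENNReal.mul_iSup]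
  refine iSup_le fun k => ?_
  have hacc : Set.accumulate Q k = ⋃ R ∈ (Finset.Iic k).image Q, R := by
    simp [Set.accumulate_def]
  rw [hacc]
  refine h𝒬.mul_measure_biUnion_finset_le _ fun R hR => ?_
  obtain ⟨i, -, rfl⟩ := Finset.mem_image.1 hR
  exact (hQ ▸ Set.mem_range_self i : Q i ∈ 𝒯)

theorem IsNestedFamily.weakNorm_familyMaximal_le (h𝒬 : IsNestedFamily 𝒬) (μ : Measure X)
    (g : X → ℝ≥0∞) : weakNorm 1 μ (familyMaximal 𝒬 μ g) ≤ ∫⁻ y, g y ∂μ :=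
  iSup₂_le fun t _ => by
    simpa only [div_one, ENNReal.rpow_one] using h𝒬.mul_measure_lt_familyMaximal_le μ g t

/-- Only the part of `g` above height `s / 2` contributes to the level set of height `s`. -/
theorem IsNestedFamily.mul_measure_lt_familyMaximal_le_withDensity (h𝒬 : IsNestedFamily 𝒬)
    (μ : Measure X) (g : X → ℝ≥0∞) (s : ℝ≥0∞) :
    s * μ {x | s < familyMaximal 𝒬 μ g x} ≤ 2 * μ.withDensity g {x | s < 2 * g x} := by
  set h := {x | s < 2 * g x}.indicator g with hh
  have hgh (x : X) : g x ≤ h x + s / 2 := by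
    by_cases hx : s < 2 * g x
    · simp [hh, hx]
    · refine le_add_left ?_
      rwa [ENNReal.le_div_iff_mul_le (by simp) (by simp), mul_comm, ← not_lt]
  have hsub : {x | s < familyMaximal 𝒬 μ g x} ⊆ {x | s / 2 < familyMaximal 𝒬 μ h x} := by
    intro x hx
    have hlt := (ENNReal.add_halves s).trans_lt (lt_of_lt_of_le hx (familyMaximal_le_add hgh x))
    exact lt_of_add_lt_add_right hlt
  calc s * μ {x | s < familyMaximal 𝒬 μ g x}
      ≤ 2 * (s / 2 * μ {x | s / 2 < familyMaximal 𝒬 μ h x}) := by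
        rw [← mul_assoc, ENNReal.mul_div_cancel two_ne_zero ENNReal.ofNat_ne_top]
        gcongr
    _ ≤ 2 * μ.withDensity g {x | s < 2 * g x} := by
        gcongr
        exact (h𝒬.mul_measure_lt_familyMaximal_le μ h _).trans
          ((lintegral_indicator_le _ _).trans (withDensity_apply_le _ _))

theorem lintegral_withDensity_lt_mul_rpow (hg : AEMeasurable g μ) (hq : 1 < q) :
    ∫⁻ s in Set.Ioi (0 : ℝ), μ.withDensity g {x | ENNReal.ofReal s < 2 * g x} *
      ENNReal.ofReal (s ^ (q - 1 - 1)) =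
        (ENNReal.ofReal (q - 1))⁻¹ * (2 ^ (q - 1) * ∫⁻ x, g x ^ q ∂μ) := by
  have hq₁ : 0 < q - 1 := by linarith
  have hg₂ : AEMeasurable (fun x => 2 * g x) μ := hg.const_mul 2
  have hcake := lintegral_rpow_eq_lintegral_measure_lt
    (hg₂.mono_ac (withDensity_absolutelyContinuous μ g)) hq₁
  rw [lintegral_withDensity_eq_lintegral_mul₀ hg (hg₂.pow_const _)] at hcake
  rw [← lintegral_const_mul'' _ (hg.pow_const q), ← ENNReal.div_eq_inv_mul,
    ENNReal.eq_div_iff (by simpa using hq) ENNReal.ofReal_ne_top, ← hcake]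
  refine lintegral_congr fun x => ?_
  rw [Pi.mul_apply, ENNReal.mul_rpow_of_nonneg _ _ hq₁.le, mul_left_comm]
  nth_rw 1 [← ENNReal.rpow_one (g x)]
  rw [← ENNReal.rpow_add_of_nonneg _ _ zero_le_one hq₁.le, add_sub_cancel]

theorem IsNestedFamily.lintegral_familyMaximal_rpow_le (h𝒬 : IsNestedFamily 𝒬)
    (hg : AEMeasurable g μ) (hq : 1 < q) :
    ∫⁻ x, familyMaximal 𝒬 μ g x ^ q ∂μ ≤
      2 ^ q * (ENNReal.ofReal q / ENNReal.ofReal (q - 1)) * ∫⁻ x, g x ^ q ∂μ := by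
  have hlevel (s : ℝ) (hs : s ∈ Set.Ioi 0) :
      μ {x | ENNReal.ofReal s < familyMaximal 𝒬 μ g x} * ENNReal.ofReal (s ^ (q - 1)) ≤
        2 * (μ.withDensity g {x | ENNReal.ofReal s < 2 * g x} *
          ENNReal.ofReal (s ^ (q - 1 - 1))) := by
    have hs₀ : s ≠ 0 := ne_of_gt hs
    have hpow : s ^ (q - 1) = s * s ^ (q - 1 - 1) := by
      rw [Real.rpow_sub_one hs₀ (q - 1), mul_div_cancel₀ _ hs₀]
    rw [hpow, ENNReal.ofReal_mul (le_of_lt hs), ← mul_assoc, ← mul_assoc, mul_comm (μ _)]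
    gcongr ?_ * _
    exact h𝒬.mul_measure_lt_familyMaximal_le_withDensity μ g _
  have hmono := setLIntegral_mono' (μ := volume) measurableSet_Ioi hlevel
  rw [lintegral_const_mul' _ _ ENNReal.ofNat_ne_top, lintegral_withDensity_lt_mul_rpow hg hq]
    at hmono
  rw [lintegral_rpow_eq_lintegral_measure_lt (h𝒬.measurable_familyMaximal μ g).aemeasurable
    (by linarith)]
  refine (mul_le_mul_right hmono _).trans (le_of_eq ?_)
  have htwo : (2 : ℝ≥0∞) ^ q = 2 * 2 ^ (q - 1) := by
    conv_lhs => rw [← add_sub_cancel 1 q,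
      ENNReal.rpow_add _ _ two_ne_zero ENNReal.ofNat_ne_top, ENNReal.rpow_one]
  rw [htwo, div_eq_mul_inv]
  ring

end NestedFamily

section ReverseHolder

variable {X : Type*} [MeasurableSpace X]

/-- A weight with respect to an arbitrary measure `μ`; for Lebesgue measure this is `IsWeight`. -/
structure IsPositiveDensity (μ : Measure X) (W : X → ℝ≥0∞) : Prop where
  aemeasurable : AEMeasurable W μ
  ne_zero : ∀ᵐ x ∂μ, W x ≠ 0
  ne_top : ∀ᵐ x ∂μ, W x ≠ ∞

/-- The reverse Hölder inequality with exponent `p` and constant `C` over the sets of `𝒬`. -/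
def ReverseHolder (𝒬 : Set (Set X)) (μ : Measure X) (p : ℝ) (C : ℝ≥0) (W : X → ℝ≥0∞) : Prop :=
  ∀ Q ∈ 𝒬, ⨍⁻ x in Q, W x ^ p ∂μ ≤ C * (⨍⁻ x in Q, W x ∂μ) ^ p

variable {𝒬 : Set (Set X)} {μ : Measure X} {W h F : X → ℝ≥0∞} {Q : Set X} {p : ℝ} {C : ℝ≥0}

theorem rpow_sub_one_mul_self {a : ℝ≥0∞} (ha₀ : a ≠ 0) (ha : a ≠ ∞) (p : ℝ) :
    a ^ (p - 1) * a = a ^ p := by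
  rw [ENNReal.rpow_sub _ _ ha₀ ha, ENNReal.rpow_one, ENNReal.div_mul_cancel ha₀ ha]

theorem IsPositiveDensity.rpow (hW : IsPositiveDensity μ W) (p : ℝ) :
    IsPositiveDensity μ (fun x => W x ^ p) where
  aemeasurable := hW.aemeasurable.pow_const p
  ne_zero := by
    filter_upwards [hW.ne_zero, hW.ne_top] with x h₀ h
    simp [ENNReal.rpow_eq_zero_iff, h₀, h]
  ne_top := by
    filter_upwards [hW.ne_zero, hW.ne_top] with x h₀ h
    simp [ENNReal.rpow_eq_top_iff, h₀, h]

theorem IsPositiveDensity.setLIntegral_withDensity_eq (hW : IsPositiveDensity μ W)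
    (hQ : MeasurableSet Q) (h : X → ℝ≥0∞) :
    ∫⁻ x in Q, h x ∂(μ.withDensity W) = ∫⁻ x in Q, W x * h x ∂μ :=
  setLIntegral_withDensity_eq_setLIntegral_mul_non_measurable₀ μ hW.aemeasurable.restrict h hQ
    (ae_restrict_of_ae (hW.ne_top.mono fun _ => Ne.lt_top))

theorem setLAverage_ne_zero (hμQ₀ : μ Q ≠ 0) (hμQ : μ Q ≠ ∞) (hW : AEMeasurable W μ)
    (hW₀ : ∀ᵐ x ∂μ, W x ≠ 0) : ⨍⁻ x in Q, W x ∂μ ≠ 0 := by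
  rw [setLAverage_eq]
  refine (ENNReal.div_ne_zero).2 ⟨fun hzero => hμQ₀ ?_, hμQ⟩
  rw [lintegral_eq_zero_iff' hW.restrict] at hzero
  rw [← Measure.restrict_eq_zero, ← ae_eq_bot, ← Filter.eventually_false_iff_eq_bot]
  filter_upwards [hzero, ae_restrict_of_ae hW₀] with x hx hx₀ using hx₀ hx

theorem IsPositiveDensity.setLAverage_withDensity_eq (hW : IsPositiveDensity μ W)
    (hQ : MeasurableSet Q) (hμQ₀ : μ Q ≠ 0) (hμQ : μ Q ≠ ∞) (h : X → ℝ≥0∞) :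
    ⨍⁻ x in Q, h x ∂(μ.withDensity W) = (⨍⁻ x in Q, W x * h x ∂μ) / ⨍⁻ x in Q, W x ∂μ := by
  simp only [setLAverage_eq, hW.setLIntegral_withDensity_eq hQ, withDensity_apply _ hQ]
  rw [div_eq_mul_inv _ (μ Q), div_eq_mul_inv _ (μ Q), ENNReal.mul_div_mul_right _ _
    (ENNReal.inv_ne_zero.2 hμQ) (ENNReal.inv_ne_top.2 hμQ₀)]

theorem IsPositiveDensity.rpow_setLAverage_withDensity_le (hW : IsPositiveDensity μ W)
    (hQ : MeasurableSet Q) (hμQ₀ : μ Q ≠ 0) (hμQ : μ Q ≠ ∞) (hWQ : ⨍⁻ x in Q, W x ∂μ ≠ ∞)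
    (hp : 1 < p) (hRH : ⨍⁻ x in Q, W x ^ p ∂μ ≤ C * (⨍⁻ x in Q, W x ∂μ) ^ p)
    (hF : ∀ᵐ y ∂μ.restrict Q, (⨍⁻ x in Q, W x * h x ∂μ) ^ (p - 1) ≤ W y ^ (p - 1) * F y) :
    (⨍⁻ x in Q, h x ∂(μ.withDensity W)) ^ (p - 1) ≤
      C * ⨍⁻ x in Q, F x ∂(μ.withDensity fun x => W x ^ p) := by
  rw [hW.setLAverage_withDensity_eq hQ hμQ₀ hμQ, (hW.rpow p).setLAverage_withDensity_eq hQ hμQ₀ hμQ]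
  set a := ⨍⁻ x in Q, W x * h x ∂μ
  set b := ⨍⁻ x in Q, W x ∂μ
  set c := ⨍⁻ x in Q, W x ^ p ∂μ
  have hb₀ : b ≠ 0 := setLAverage_ne_zero hμQ₀ hμQ hW.aemeasurable hW.ne_zero
  have hc₀ : c ≠ 0 := setLAverage_ne_zero hμQ₀ hμQ (hW.rpow p).aemeasurable (hW.rpow p).ne_zero
  have hbp₀ : b ^ (p - 1) ≠ 0 := by simp [ENNReal.rpow_eq_zero_iff, hb₀, hWQ]
  have hbptop : b ^ (p - 1) ≠ ∞ := ENNReal.rpow_ne_top_of_nonneg (by linarith) hWQ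
  have hc : c ≠ ∞ := ne_top_of_le_ne_top (by finiteness) hRH
  have haverage : a ^ (p - 1) * b ≤ ⨍⁻ x in Q, W x ^ p * F x ∂μ := by
    refine (lintegral_const_mul_le _ _).trans (laverage_mono_ae ?_)
    filter_upwards [hF, ae_restrict_of_ae hW.ne_zero, ae_restrict_of_ae hW.ne_top] with y hy h₀ htop
    calc a ^ (p - 1) * W y ≤ W y ^ (p - 1) * F y * W y := by gcongr
      _ = W y ^ p * F y := by
        rw [mul_right_comm, rpow_sub_one_mul_self h₀ htop]
  rw [ENNReal.div_rpow_of_nonneg _ _ (by linarith : 0 ≤ p - 1), ← mul_div_assoc,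
    ENNReal.le_div_iff_mul_le (.inl hc₀) (.inl hc), ← ENNReal.mul_div_right_comm,
    ENNReal.div_le_iff hbp₀ hbptop]
  calc a ^ (p - 1) * c ≤ a ^ (p - 1) * (C * (b ^ (p - 1) * b)) := by
        rw [rpow_sub_one_mul_self hb₀ hWQ]
        gcongr
    _ = C * (a ^ (p - 1) * b) * b ^ (p - 1) := by ring
    _ ≤ _ := by gcongr

theorem ReverseHolder.rpow_familyMaximal_withDensity_le (hRH : ReverseHolder 𝒬 μ p C W)
    (h𝒬 : IsNestedFamily 𝒬) (hμ₀ : ∀ Q ∈ 𝒬, μ Q ≠ 0) (hμ : ∀ Q ∈ 𝒬, μ Q ≠ ∞)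
    (hW : IsPositiveDensity μ W) (hWtop : ∀ Q ∈ 𝒬, ⨍⁻ x in Q, W x ∂μ ≠ ∞) (hp : 1 < p) {t : ℝ≥0∞}
    (hF : ∀ᵐ y ∂μ, min (familyMaximal 𝒬 μ (fun x => W x * h x) y) t ^ (p - 1) ≤
      W y ^ (p - 1) * F y)
    {x : X} (hx : familyMaximal 𝒬 μ (fun x => W x * h x) x ≤ t) :
    familyMaximal 𝒬 (μ.withDensity W) h x ^ (p - 1) ≤
      C * familyMaximal 𝒬 (μ.withDensity fun x => W x ^ p) F x := by
  have hp₁ : 0 < p - 1 := by linarith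
  rw [← ENNReal.le_rpow_inv_iff hp₁]
  refine iSup₂_le fun Q hQ => iSup_le fun hxQ => ?_
  rw [ENNReal.le_rpow_inv_iff hp₁]
  calc (⨍⁻ y in Q, h y ∂(μ.withDensity W)) ^ (p - 1)
      ≤ C * ⨍⁻ y in Q, F y ∂(μ.withDensity fun x => W x ^ p) := by
        refine hW.rpow_setLAverage_withDensity_le (h𝒬.measurableSet Q hQ) (hμ₀ Q hQ) (hμ Q hQ)
          (hWtop Q hQ) hp (hRH Q hQ) ?_
        filter_upwards [ae_restrict_of_ae hF, ae_restrict_mem (h𝒬.measurableSet Q hQ)] with y hy hyQ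
        refine le_trans ?_ hy
        gcongr
        exact le_min (setLAverage_le_familyMaximal hQ hyQ)
          ((setLAverage_le_familyMaximal hQ hxQ).trans hx)
    _ ≤ _ := by gcongr; exact setLAverage_le_familyMaximal hQ hxQ

theorem IsPositiveDensity.lintegral_rpow_mul_familyMaximal_rpow_le (hW : IsPositiveDensity μ W)
    (h𝒬 : IsNestedFamily 𝒬) (hF : AEMeasurable F μ) (p : ℝ) {q : ℝ} (hq : 1 < q) :
    ∫⁻ x, W x ^ p * familyMaximal 𝒬 (μ.withDensity fun x => W x ^ p) F x ^ q ∂μ ≤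
      2 ^ q * (ENNReal.ofReal q / ENNReal.ofReal (q - 1)) * ∫⁻ x, W x ^ p * F x ^ q ∂μ := by
  have hWp := (hW.rpow p).aemeasurable
  have hM := (h𝒬.measurable_familyMaximal (μ.withDensity fun x => W x ^ p) F).pow_const q
  have hstrong := h𝒬.lintegral_familyMaximal_rpow_le
    (hF.mono_ac (withDensity_absolutelyContinuous μ fun x => W x ^ p)) hq
  rwa [lintegral_withDensity_eq_lintegral_mul₀ hWp hM.aemeasurable,
    lintegral_withDensity_eq_lintegral_mul₀ hWp (hF.pow_const q)] at hstrong

theorem IsPositiveDensity.ae_rpow_mul_rpow_conjExponent_eq (hW : IsPositiveDensity μ W)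
    (hp : 1 < p) (H : X → ℝ≥0∞) :
    ∀ᵐ x ∂μ, W x ^ p * (H x ^ (p - 1) * W x ^ (1 - p)) ^ (p / (p - 1)) = H x ^ p := by
  have hp₁ : 0 < p - 1 := by linarith
  filter_upwards [hW.ne_zero, hW.ne_top] with x h₀ h
  have hexp : (1 - p) * (p / (p - 1)) = -p := by field_simp; ring
  rw [ENNReal.mul_rpow_of_nonneg _ _ (by positivity : 0 ≤ p / (p - 1)), ← ENNReal.rpow_mul,
    ← ENNReal.rpow_mul, mul_div_cancel₀ _ hp₁.ne', hexp, mul_left_comm,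
    ← ENNReal.rpow_add _ _ h₀ h, add_neg_cancel, ENNReal.rpow_zero, mul_one]

theorem IsPositiveDensity.mul_measure_le_mul_familyMaximal_le (hW : IsPositiveDensity μ W)
    (h𝒬 : IsNestedFamily 𝒬) (hp : 1 < p) {q : ℝ} (hq : q = p / (p - 1)) {f : X → ℝ≥0∞}
    (hf : AEMeasurable f μ) {t : ℝ≥0} (ht : 0 < t) (D : ℝ≥0∞) :
    t * μ {x | (t : ℝ≥0∞) ^ p ≤ D * (W x ^ p * familyMaximal 𝒬 (μ.withDensity fun x => W x ^ p)
        (fun x => min (f x) t ^ (p - 1) * W x ^ (1 - p)) x ^ q)} ≤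
      D * (2 ^ q * (ENNReal.ofReal q / ENNReal.ofReal (q - 1)) *
        (ENNReal.ofReal p / ENNReal.ofReal (p - 1))) * weakNorm 1 μ f := by
  have hq₁ : 1 < q := by rw [hq, lt_div_iff₀ (by linarith)]; linarith
  set F := fun x => min (f x) t ^ (p - 1) * W x ^ (1 - p)
  set L := familyMaximal 𝒬 (μ.withDensity fun x => W x ^ p) F
  have hFm : AEMeasurable F μ := ((hf.min aemeasurable_const).pow_const _).mul
    (hW.aemeasurable.pow_const _)
  have hLm : AEMeasurable (fun x => W x ^ p * L x ^ q) μ :=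
    (hW.rpow p).aemeasurable.mul
      ((h𝒬.measurable_familyMaximal _ F).pow_const q).aemeasurable
  have ht₀ : (t : ℝ≥0∞) ≠ 0 := by exact_mod_cast ht.ne'
  have htpow₀ : (t : ℝ≥0∞) ^ (p - 1) ≠ 0 := by simp [ENNReal.rpow_eq_zero_iff, ht₀]
  have htpow : (t : ℝ≥0∞) ^ (p - 1) ≠ ∞ := by simp [ENNReal.rpow_eq_top_iff, ht₀]
  rw [← ENNReal.mul_le_mul_iff_right htpow₀ htpow, ← mul_assoc,
    rpow_sub_one_mul_self ht₀ ENNReal.coe_ne_top]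
  calc (t : ℝ≥0∞) ^ p * μ {x | (t : ℝ≥0∞) ^ p ≤ D * (W x ^ p * L x ^ q)}
      ≤ D * ∫⁻ x, W x ^ p * L x ^ q ∂μ := by
        rw [← lintegral_const_mul'' _ hLm]
        exact mul_meas_ge_le_lintegral₀ (hLm.const_mul D) _
    _ ≤ D * (2 ^ q * (ENNReal.ofReal q / ENNReal.ofReal (q - 1)) * ∫⁻ x, min (f x) t ^ p ∂μ) := by
        rw [← lintegral_congr_ae (hW.ae_rpow_mul_rpow_conjExponent_eq hp fun x => min (f x) t),
          ← hq]
        gcongr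
        exact hW.lintegral_rpow_mul_familyMaximal_rpow_le h𝒬 hFm p hq₁
    _ ≤ D * (2 ^ q * (ENNReal.ofReal q / ENNReal.ofReal (q - 1)) *
          (ENNReal.ofReal p / ENNReal.ofReal (p - 1) * t ^ (p - 1) * weakNorm 1 μ f)) := by
        gcongr
        exact lintegral_min_rpow_le_weakNorm hf hp t
    _ = _ := by ring

theorem ReverseHolder.lt_mul_familyMaximal_subset (hRH : ReverseHolder 𝒬 μ p C W)
    (h𝒬 : IsNestedFamily 𝒬) (hμ₀ : ∀ Q ∈ 𝒬, μ Q ≠ 0) (hμ : ∀ Q ∈ 𝒬, μ Q ≠ ∞)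
    (hW : IsPositiveDensity μ W) (hWtop : ∀ Q ∈ 𝒬, ⨍⁻ x in Q, W x ∂μ ≠ ∞) (hp : 1 < p)
    {q : ℝ} (hq : q = p / (p - 1)) (t : ℝ≥0∞) :
    {x | t < W x * familyMaximal 𝒬 (μ.withDensity W) h x} ⊆
      {x | t < familyMaximal 𝒬 μ (fun x => W x * h x) x} ∪
      {x | t ^ p ≤ (C : ℝ≥0∞) ^ q * (W x ^ p *
        familyMaximal 𝒬 (μ.withDensity fun x => W x ^ p) (fun x =>
          min (familyMaximal 𝒬 μ (fun x => W x * h x) x) t ^ (p - 1) * W x ^ (1 - p)) x ^ q)} := by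
  have hp₁ : 0 < p - 1 := by linarith
  have hq₀ : 0 ≤ q := by rw [hq]; positivity
  set N := familyMaximal 𝒬 (μ.withDensity W) h
  set M := familyMaximal 𝒬 μ (fun x => W x * h x)
  set F := fun x => min (M x) t ^ (p - 1) * W x ^ (1 - p) with hF
  have hFW : ∀ᵐ y ∂μ, min (M y) t ^ (p - 1) ≤ W y ^ (p - 1) * F y := by
    filter_upwards [hW.ne_zero, hW.ne_top] with y h₀ htop
    rw [hF, mul_left_comm, ← ENNReal.rpow_add _ _ h₀ htop]
    simp
  intro x (hx : t < W x * N x)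
  refine (lt_or_ge t (M x)).imp id fun hMx => ?_
  have hNp : N x ^ p = (N x ^ (p - 1)) ^ q := by
    rw [← ENNReal.rpow_mul, hq, mul_div_cancel₀ _ hp₁.ne']
  calc t ^ p ≤ (W x * N x) ^ p := by gcongr
    _ = W x ^ p * (N x ^ (p - 1)) ^ q := by
        rw [ENNReal.mul_rpow_of_nonneg _ _ (by linarith), hNp]
    _ ≤ W x ^ p * (C * familyMaximal 𝒬 (μ.withDensity fun x => W x ^ p) F x) ^ q := by
        gcongr
        exact hRH.rpow_familyMaximal_withDensity_le h𝒬 hμ₀ hμ hW hWtop hp hFW hMx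
    _ = _ := by rw [ENNReal.mul_rpow_of_nonneg _ _ hq₀]; ring

/-- Sawyer's argument. Off `{t < M_μ (W h)}` the reverse Hölder inequality dominates
`(M_{W μ} h)^{p-1}` by the `W^p μ`-maximal function of `F = min(M_μ (W h), t)^{p-1} W^{1-p}`,
whose `L^{p'}(W^p μ)` norm is controlled by the truncated `L^p(μ)` norm of `M_μ (W h)`. -/
theorem ReverseHolder.exists_weakNorm_mul_familyMaximal_le (hRH : ReverseHolder 𝒬 μ p C W)
    (h𝒬 : IsNestedFamily 𝒬) (hμ₀ : ∀ Q ∈ 𝒬, μ Q ≠ 0) (hμ : ∀ Q ∈ 𝒬, μ Q ≠ ∞)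
    (hW : IsPositiveDensity μ W) (hWtop : ∀ Q ∈ 𝒬, ⨍⁻ x in Q, W x ∂μ ≠ ∞) (hp : 1 < p) :
    ∃ K : ℝ≥0, ∀ h : X → ℝ≥0∞,
      weakNorm 1 μ (fun x => W x * familyMaximal 𝒬 (μ.withDensity W) h x) ≤
        K * ∫⁻ x, W x * h x ∂μ := by
  set q := p / (p - 1) with hq
  have hq₁ : 1 < q := by rw [hq, lt_div_iff₀ (by linarith)]; linarith
  have hdiv {s : ℝ} (hs : 1 < s) : ENNReal.ofReal s / ENNReal.ofReal (s - 1) ≠ ∞ :=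
    ENNReal.div_ne_top ENNReal.ofReal_ne_top (by simpa using hs)
  set A : ℝ≥0∞ := (C : ℝ≥0∞) ^ q * (2 ^ q * (ENNReal.ofReal q / ENNReal.ofReal (q - 1)) *
    (ENNReal.ofReal p / ENNReal.ofReal (p - 1)))
  have hAtop : 1 + A ≠ ∞ := by
    have := hdiv hp
    have := hdiv hq₁
    finiteness
  refine ⟨(1 + A).toNNReal, fun h => ?_⟩
  rw [ENNReal.coe_toNNReal hAtop]
  refine iSup₂_le fun t ht => ?_
  set M := familyMaximal 𝒬 μ (fun x => W x * h x)
  have hsubset := hRH.lt_mul_familyMaximal_subset (h := h) h𝒬 hμ₀ hμ hW hWtop hp hq t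
  rw [div_one, ENNReal.rpow_one]
  calc _ ≤ t * μ {x | (t : ℝ≥0∞) < M x} + t * μ _ := by
        rw [← mul_add]
        gcongr
        exact (measure_mono hsubset).trans (measure_union_le _ _)
    _ ≤ (∫⁻ x, W x * h x ∂μ) + A * ∫⁻ x, W x * h x ∂μ := by
        refine add_le_add (h𝒬.mul_measure_lt_familyMaximal_le μ _ t) ?_
        refine (hW.mul_measure_le_mul_familyMaximal_le h𝒬 hp hq
          (h𝒬.measurable_familyMaximal μ _).aemeasurable ht _).trans ?_
        gcongr
        exact h𝒬.weakNorm_familyMaximal_le μ _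
    _ = (1 + A) * ∫⁻ x, W x * h x ∂μ := by ring

end ReverseHolder

section Dyadic

variable {n : ℕ}

theorem volume_cube (a : Fin n → ℝ) (l : ℝ) : volume (cube a l) = ENNReal.ofReal l ^ n := by
  simp [cube, Real.volume_Icc_pi]

theorem avg_eq_setLAverage (a : Fin n → ℝ) (l : ℝ) (g : (Fin n → ℝ) → ℝ≥0∞) :
    avg a l g = ⨍⁻ x in cube a l, g x ∂volume := by
  rw [avg, setLAverage_eq, ENNReal.div_eq_inv_mul]

/-- The translation, in units of `2⁻ᵏ`, of the `k`-th generation of a shifted dyadic grid along one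
axis: `0` for the standard grid, `(-1)ᵏ / 3` for the shifted one. The sign alternates since `k ↦ θₖ`
has to satisfy `2 θₖ - θₖ₊₁ ∈ ℤ` for the generations to be nested. -/
def dyadicShift (c : Fin 2) (k : ℤ) : ℝ :=
  ((c : ℤ) * k.negOnePow : ℤ) / 3

/-- The index of the cube of generation `k`, in the dyadic grid with shifts `c`, that contains
the point `y`. -/
def dyadicIndex (c : Fin n → Fin 2) (k : ℤ) (y : Fin n → ℝ) (j : Fin n) : ℤ :=
  ⌊y j * 2 ^ k + dyadicShift (c j) k⌋

/-- The half-open dyadic cube of side length `2⁻ᵏ` with index `z` in the dyadic grid with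
shifts `c`. -/
def dyadicCube (c : Fin n → Fin 2) (k : ℤ) (z : Fin n → ℤ) : Set (Fin n → ℝ) :=
  {y | dyadicIndex c k y = z}

/-- The lower corner of `dyadicCube c k z`. -/
def dyadicCorner (c : Fin n → Fin 2) (k : ℤ) (z : Fin n → ℤ) (j : Fin n) : ℝ :=
  (z j - dyadicShift (c j) k) * (2 ^ k)⁻¹

/-- The index of the cube of generation `k` that contains the cube of generation `k + 1` with
index `z`. -/
def dyadicParent (c : Fin n → Fin 2) (k : ℤ) (z : Fin n → ℤ) (j : Fin n) : ℤ :=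
  (z j + (c j : ℤ) * k.negOnePow) / 2

/-- The dyadic grid with shifts `c`: the family of its cubes of all generations. -/
def dyadicGrid (c : Fin n → Fin 2) : Set (Set (Fin n → ℝ)) :=
  Set.range fun i : ℤ × (Fin n → ℤ) => dyadicCube c i.1 i.2

variable (c : Fin n → Fin 2) (k : ℤ) (z : Fin n → ℤ)

theorem dyadicCube_mem_dyadicGrid : dyadicCube c k z ∈ dyadicGrid c :=
  ⟨(k, z), rfl⟩

theorem mem_dyadicCube_dyadicIndex (y : Fin n → ℝ) : y ∈ dyadicCube c k (dyadicIndex c k y) :=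
  rfl

theorem dyadicCube_eq_pi_Ico :
    dyadicCube c k z =
      Set.univ.pi fun j => Set.Ico (dyadicCorner c k z j) (dyadicCorner c k z j + (2 ^ k)⁻¹) := by
  ext y
  change dyadicIndex c k y = z ↔ _
  simp only [funext_iff, Set.mem_univ_pi, Set.mem_Ico, dyadicIndex, dyadicCorner]
  refine forall_congr' fun j => ?_
  have h2 : (0 : ℝ) < 2 ^ k := by positivity
  rw [← add_one_mul, Int.floor_eq_iff, ← div_eq_mul_inv, ← div_eq_mul_inv, div_le_iff₀ h2,
    lt_div_iff₀ h2]
  constructor <;> rintro ⟨h, h'⟩ <;> constructor <;> linarith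

theorem measurableSet_dyadicCube : MeasurableSet (dyadicCube c k z) := by
  rw [dyadicCube_eq_pi_Ico]
  exact MeasurableSet.univ_pi fun j => measurableSet_Ico

theorem dyadicCube_ae_eq_cube :
    dyadicCube c k z =ᵐ[volume] cube (dyadicCorner c k z) (2 ^ k)⁻¹ := by
  rw [dyadicCube_eq_pi_Ico]
  exact Measure.univ_pi_Ico_ae_eq_Icc

theorem dyadicCube_subset_cube : dyadicCube c k z ⊆ cube (dyadicCorner c k z) (2 ^ k)⁻¹ := by
  rw [dyadicCube_eq_pi_Ico, cube, ← Set.pi_univ_Icc]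
  exact Set.pi_mono fun j _ => Set.Ico_subset_Icc_self

theorem volume_dyadicCube : volume (dyadicCube c k z) = ENNReal.ofReal (2 ^ k)⁻¹ ^ n := by
  rw [measure_congr (dyadicCube_ae_eq_cube c k z), volume_cube]

theorem volume_dyadicCube_ne_zero : volume (dyadicCube c k z) ≠ 0 := by
  rw [volume_dyadicCube]
  exact pow_ne_zero _ (ENNReal.ofReal_pos.2 (by positivity)).ne'

theorem volume_dyadicCube_ne_top : volume (dyadicCube c k z) ≠ ∞ := by
  rw [volume_dyadicCube]
  exact ENNReal.pow_ne_top ENNReal.ofReal_ne_top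

theorem restrict_dyadicCube :
    volume.restrict (dyadicCube c k z) =
      volume.restrict (cube (dyadicCorner c k z) (2 ^ k)⁻¹) :=
  Measure.restrict_congr_set (dyadicCube_ae_eq_cube c k z)

theorem avg_dyadicCorner (g : (Fin n → ℝ) → ℝ≥0∞) :
    avg (dyadicCorner c k z) (2 ^ k)⁻¹ g = ⨍⁻ x in dyadicCube c k z, g x ∂volume := by
  rw [avg_eq_setLAverage, restrict_dyadicCube]

theorem dyadicParent_dyadicIndex (y : Fin n → ℝ) :
    dyadicParent c k (dyadicIndex c (k + 1) y) = dyadicIndex c k y := by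
  ext j
  have h : y j * 2 ^ k + dyadicShift (c j) k =
      (y j * 2 ^ (k + 1) + dyadicShift (c j) (k + 1) + ((c j : ℤ) * k.negOnePow : ℤ)) /
        (2 : ℕ) := by
    simp only [dyadicShift, zpow_add_one₀ (two_ne_zero' ℝ), Int.negOnePow_succ]
    push_cast
    ring
  rw [dyadicIndex, h, Int.floor_div_natCast, Int.floor_add_intCast]
  rfl

variable {c k} in
theorem dyadicIndex_eq_of_le {k' : ℤ} (hk : k ≤ k') {x y : Fin n → ℝ}
    (h : dyadicIndex c k' x = dyadicIndex c k' y) : dyadicIndex c k x = dyadicIndex c k y := by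
  induction k', hk using Int.leInduction with
  | base => exact h
  | succ k' _ ih =>
    refine ih ?_
    rw [← dyadicParent_dyadicIndex, h, dyadicParent_dyadicIndex]

variable {c k z} in
theorem dyadicCube_subset_of_not_disjoint {k' : ℤ} {z' : Fin n → ℤ} (hk : k ≤ k')
    (h : ¬Disjoint (dyadicCube c k z) (dyadicCube c k' z')) :
    dyadicCube c k' z' ⊆ dyadicCube c k z := by
  obtain ⟨x, hx, hx'⟩ := Set.not_disjoint_iff.1 h
  exact fun y hy => (dyadicIndex_eq_of_le hk (Eq.trans hy (Eq.symm hx'))).trans hx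

theorem isNestedFamily_dyadicGrid : IsNestedFamily (dyadicGrid c) where
  countable := Set.countable_range _
  measurableSet := by
    rintro _ ⟨i, rfl⟩
    exact measurableSet_dyadicCube c _ _
  disjoint_or_subset := by
    rintro _ ⟨⟨k, z⟩, rfl⟩ _ ⟨⟨k', z'⟩, rfl⟩
    refine or_iff_not_imp_left.2 fun hd => ?_
    rcases le_total k k' with h | h
    · exact Or.inr (dyadicCube_subset_of_not_disjoint h hd)
    · exact Or.inl (dyadicCube_subset_of_not_disjoint h fun hd' => hd hd'.symm)

theorem dyadicCube_eq_iUnion_children :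
    dyadicCube c k z = ⋃ z' : {z' // dyadicParent c k z' = z}, dyadicCube c (k + 1) z' := by
  ext y
  simp only [Set.mem_iUnion, dyadicCube, Set.mem_ofPred_eq]
  constructor
  · exact fun hy => ⟨⟨_, (dyadicParent_dyadicIndex c k y).trans hy⟩, rfl⟩
  · rintro ⟨⟨z', hz'⟩, hy⟩
    rw [← dyadicParent_dyadicIndex, hy, hz']

theorem setLIntegral_dyadicCube_eq_tsum (g : (Fin n → ℝ) → ℝ≥0∞) :
    ∫⁻ x in dyadicCube c k z, g x =
      ∑' z' : {z' // dyadicParent c k z' = z}, ∫⁻ x in dyadicCube c (k + 1) z', g x := by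
  rw [dyadicCube_eq_iUnion_children, lintegral_iUnion fun _ => measurableSet_dyadicCube _ _ _]
  exact fun z₁ z₂ h => Set.disjoint_left.2 fun y hy₁ hy₂ =>
    h (Subtype.ext (Eq.trans (Eq.symm hy₁) hy₂))

/-- The endpoints of an interval of length `h < 1 / 3` cannot be separated both by `ℤ` and by
`ℤ ± 1 / 3`. -/
theorem exists_floor_add_dyadicShift_eq {b h : ℝ} (h0 : 0 ≤ h) (hh : 3 * h < 1) (k : ℤ) :
    ∃ c : Fin 2, ⌊b + dyadicShift c k⌋ = ⌊b + h + dyadicShift c k⌋ := by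
  by_contra! hne
  have h₀ := Int.floor_lt.1 (lt_of_le_of_ne (Int.floor_mono (by linarith)) (hne 0))
  have h₁ := Int.floor_lt.1 (lt_of_le_of_ne (Int.floor_mono (by linarith)) (hne 1))
  have h₀' := Int.floor_le (b + h + dyadicShift 0 k)
  have h₁' := Int.floor_le (b + h + dyadicShift 1 k)
  set i := ⌊b + h + dyadicShift 0 k⌋
  set j := ⌊b + h + dyadicShift 1 k⌋
  simp only [dyadicShift, Fin.val_zero, Fin.val_one, Nat.cast_zero, Nat.cast_one, zero_mul,
    one_mul, Int.cast_zero, zero_div, add_zero] at h₀ h₁ h₀' h₁'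
  obtain ⟨N, hN, hN'⟩ : ∃ N : ℤ, (k.negOnePow : ℤ) = N ∧ (N = 1 ∨ N = -1) :=
    ⟨_, rfl, Int.isUnit_iff.1 k.negOnePow.isUnit⟩
  rw [hN] at h₁ h₁'
  have hlt : -1 < 3 * (i - j) + N := by exact_mod_cast (by linarith : (-1 : ℝ) < 3 * (i - j) + N)
  have hgt : 3 * (i - j) + N < 1 := by exact_mod_cast (by linarith : (3 * (i - j) + N : ℝ) < 1)
  omega

theorem exists_cube_subset_dyadicCube (a : Fin n → ℝ) {l : ℝ} (hl : 0 < l) :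
    ∃ c k z, cube a l ⊆ dyadicCube c k z ∧ ((2 : ℝ) ^ k)⁻¹ ≤ 6 * l := by
  obtain ⟨e, he, he'⟩ := exists_mem_Ico_zpow (x := 3 * l) (y := (2 : ℝ)) (by positivity) one_lt_two
  set k := -(e + 1) with hk
  have h2k : ((2 : ℝ) ^ k)⁻¹ = 2 ^ (e + 1) := by rw [hk, zpow_neg, inv_inv]
  have hlk : 3 * (l * 2 ^ k) < 1 := by
    rw [hk, zpow_neg, ← mul_assoc, ← div_eq_mul_inv, div_lt_one (by positivity)]
    exact he'
  choose c hc using fun j => exists_floor_add_dyadicShift_eq (b := a j * 2 ^ k)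
    (by positivity) hlk k
  refine ⟨c, k, dyadicIndex c k a, fun y hy => funext fun j => ?_, ?_⟩
  · have hay : a j ≤ y j := hy.1 j
    have hya : y j ≤ a j + l := hy.2 j
    refine le_antisymm ?_ (Int.floor_mono (by gcongr))
    rw [dyadicIndex, dyadicIndex, hc j, ← add_mul]
    exact Int.floor_mono (by gcongr)
  · rw [h2k, zpow_add_one₀ two_ne_zero]
    linarith

variable {c k z} in
theorem avg_le_setLAverage_dyadicCube {a : Fin n → ℝ} {l : ℝ}
    (hsub : cube a l ⊆ dyadicCube c k z) (hkl : ((2 : ℝ) ^ k)⁻¹ ≤ 6 * l)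
    (g : (Fin n → ℝ) → ℝ≥0∞) :
    avg a l g ≤ 6 ^ n * ⨍⁻ x in dyadicCube c k z, g x ∂volume := by
  have hvol : volume (dyadicCube c k z) ≤ 6 ^ n * volume (cube a l) := by
    rw [volume_dyadicCube, volume_cube, ← mul_pow]
    gcongr
    rw [← ENNReal.ofReal_ofNat 6, ← ENNReal.ofReal_mul (by norm_num)]
    exact ENNReal.ofReal_le_ofReal hkl
  have hinv : (volume (cube a l))⁻¹ ≤ 6 ^ n * (volume (dyadicCube c k z))⁻¹ := by
    rw [← div_eq_mul_inv, ENNReal.le_div_iff_mul_le (Or.inl (volume_dyadicCube_ne_zero c k z))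
      (Or.inl (volume_dyadicCube_ne_top c k z)), mul_comm, ← div_eq_mul_inv]
    exact ENNReal.div_le_of_le_mul hvol
  calc avg a l g ≤ 6 ^ n * (volume (dyadicCube c k z))⁻¹ * ∫⁻ x in dyadicCube c k z, g x := by
        rw [avg]; gcongr
    _ = 6 ^ n * ⨍⁻ x in dyadicCube c k z, g x ∂volume := by
        rw [setLAverage_eq, ENNReal.div_eq_inv_mul, mul_assoc]

end Dyadic

section AOne

/-- The condition `A_1` with constant `C` for averages over the members of the family `𝒬`. -/
def AOneOn {X : Type*} [MeasurableSpace X] (𝒬 : Set (Set X)) (μ : Measure X) (C : ℝ≥0)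
    (u : X → ℝ≥0∞) : Prop :=
  ∀ Q ∈ 𝒬, ⨍⁻ x in Q, u x ∂μ ≤ C * essInf u (μ.restrict Q)

/-- The Bellman function `m ↦ 2 J m ^ ε - V m ^ (1 + ε)` is antitone where `J ≤ K m V`. -/
theorem two_mul_mul_rpow_add_le {J V m m' K ε : ℝ} (hm : 0 < m) (hmm' : m ≤ m') (hJ : 0 ≤ J)
    (hV : 0 ≤ V) (hJK : J ≤ K * m * V) (hε : 0 ≤ ε) (hε1 : ε ≤ 1) (hKε : 2 * (K * ε) ≤ 1) :
    2 * J * m' ^ ε + V * m ^ (1 + ε) ≤ 2 * J * m ^ ε + V * m' ^ (1 + ε) := by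
  have hm' : 0 < m' := hm.trans_le hmm'
  have hbernoulli : m' ^ ε - m ^ ε ≤ ε * (m' / m - 1) * m ^ ε := by
    have h := rpow_one_add_le_one_add_mul_self (s := m' / m - 1)
      (by linarith [div_pos hm' hm]) hε hε1
    rw [add_sub_cancel, Real.div_rpow hm'.le hm.le, div_le_iff₀ (by positivity)] at h
    linarith
  have hdiff : 0 ≤ m' / m - 1 := by
    rw [sub_nonneg, one_le_div hm]
    exact hmm'
  have hmono : V * m' * m ^ ε ≤ V * m' * m' ^ ε := by gcongr
  have hkey : 2 * J * (m' ^ ε - m ^ ε) ≤ V * (m ^ ε * (m' - m)) := by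
    calc 2 * J * (m' ^ ε - m ^ ε) ≤ 2 * J * (ε * (m' / m - 1) * m ^ ε) := by gcongr
      _ ≤ 2 * (K * m * V) * (ε * (m' / m - 1) * m ^ ε) := by gcongr
      _ = 2 * (K * ε) * (V * (m ^ ε * (m' - m))) := by field_simp
      _ ≤ 1 * (V * (m ^ ε * (m' - m))) := by
        have : 0 ≤ m' - m := sub_nonneg.2 hmm'
        gcongr
      _ = V * (m ^ ε * (m' - m)) := one_mul _
  rw [Real.rpow_add hm, Real.rpow_one, Real.rpow_add hm', Real.rpow_one]
  linarith

theorem ennreal_two_mul_mul_rpow_add_le {J V m m' : ℝ≥0∞} {K : ℝ≥0} {ε : ℝ} (hmm' : m ≤ m')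
    (hm' : m' ≠ ∞) (hV : V ≠ ∞) (hJK : J ≤ K * m * V) (hε : 0 < ε) (hε1 : ε ≤ 1)
    (hKε : 2 * (K * ε) ≤ 1) :
    2 * J * m' ^ ε + V * m ^ (1 + ε) ≤ 2 * J * m ^ ε + V * m' ^ (1 + ε) := by
  have hε2 : 0 < 1 + ε := by linarith
  have hm : m ≠ ∞ := ne_top_of_le_ne_top hm' hmm'
  rcases eq_or_ne m 0 with rfl | hm0
  · obtain rfl : J = 0 := by simpa using hJK
    simp [hε2]
  have hJ : J ≠ ∞ := ne_top_of_le_ne_top (by finiteness) hJK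
  lift m to ℝ≥0 using hm
  lift m' to ℝ≥0 using hm'
  lift J to ℝ≥0 using hJ
  lift V to ℝ≥0 using hV
  have hm0' : m ≠ 0 := by simpa using hm0
  simp only [← ENNReal.coe_rpow_of_nonneg _ hε.le, ← ENNReal.coe_rpow_of_nonneg _ hε2.le]
  norm_cast at hJK hmm' ⊢
  rw [← NNReal.coe_le_coe] at hJK hmm' ⊢
  push_cast at hJK ⊢
  exact two_mul_mul_rpow_add_le (by positivity) hmm' J.2 V.2 hJK hε.le hε1 hKε

theorem add_mul_rpow_mul_le_of_le {I D J V m m' : ℝ≥0∞} {K : ℝ≥0} {ε : ℝ} (hmm' : m ≤ m')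
    (hm' : m' ≠ ∞) (hV : V ≠ ∞) (hD : D ≠ ∞) (hJK : J ≤ K * m * V) (hε : 0 < ε) (hε1 : ε ≤ 1)
    (hKε : 2 * (K * ε) ≤ 1) (h : I + D * (m' ^ (1 + ε) * V) ≤ D * (2 * m' ^ ε * J)) :
    I + D * (m ^ (1 + ε) * V) ≤ D * (2 * m ^ ε * J) := by
  have hbellman := ennreal_two_mul_mul_rpow_add_le hmm' hm' hV hJK hε hε1 hKε
  have hm : m ≠ ∞ := ne_top_of_le_ne_top hm' hmm'
  have hJ : J ≠ ∞ := ne_top_of_le_ne_top (by finiteness) hJK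
  have hpow : m' ^ (1 + ε) ≠ ∞ := ENNReal.rpow_ne_top_of_nonneg (by linarith) hm'
  have hpow' : m' ^ ε ≠ ∞ := ENNReal.rpow_ne_top_of_nonneg hε.le hm'
  have hfin : D * (m' ^ (1 + ε) * V) + D * (2 * m' ^ ε * J) ≠ ∞ := by finiteness
  refine (ENNReal.add_le_add_iff_right hfin).1 ?_
  calc I + D * (m ^ (1 + ε) * V) + (D * (m' ^ (1 + ε) * V) + D * (2 * m' ^ ε * J))
      = I + D * (m' ^ (1 + ε) * V) + D * (2 * J * m' ^ ε + V * m ^ (1 + ε)) := by ring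
    _ ≤ D * (2 * m' ^ ε * J) + D * (2 * J * m ^ ε + V * m' ^ (1 + ε)) := by gcongr
    _ = D * (2 * m ^ ε * J) + (D * (m' ^ (1 + ε) * V) + D * (2 * m' ^ ε * J)) := by ring

theorem essInf_le_setLAverage {X : Type*} [MeasurableSpace X] {μ : Measure X} {Q : Set X}
    (hQ₀ : μ Q ≠ 0) (hQ : μ Q ≠ ∞) (u : X → ℝ≥0∞) :
    essInf u (μ.restrict Q) ≤ ⨍⁻ x in Q, u x ∂μ := by
  calc essInf u (μ.restrict Q) = ⨍⁻ _ in Q, essInf u (μ.restrict Q) ∂μ :=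
        (setLAverage_const hQ₀ hQ _).symm
    _ ≤ ⨍⁻ x in Q, u x ∂μ := laverage_mono_ae ae_essInf_le

variable {n : ℕ}

/-- The conditional expectation of `u` given generation `k` of the dyadic grid with shifts `c`. -/
def dyadicExpect (c : Fin n → Fin 2) (u : (Fin n → ℝ) → ℝ≥0∞) (k : ℤ) (y : Fin n → ℝ) : ℝ≥0∞ :=
  ⨍⁻ x in dyadicCube c k (dyadicIndex c k y), u x ∂volume

theorem measurable_dyadicExpect (c : Fin n → Fin 2) (u : (Fin n → ℝ) → ℝ≥0∞) (k : ℤ) :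
    Measurable (dyadicExpect c u k) := by
  have h : Measurable (dyadicIndex c k) :=
    measurable_pi_lambda _ fun j => Measurable.floor (by fun_prop)
  exact (measurable_of_countable fun z => ⨍⁻ x in dyadicCube c k z, u x ∂volume).comp h

theorem cube_eq_closedBall (a : Fin n → ℝ) {l : ℝ} (hl : 0 ≤ l) :
    cube a l = Metric.closedBall (fun j => a j + l / 2) (l / 2) := by
  rw [closedBall_pi _ (by positivity), cube, ← Set.pi_univ_Icc]
  congr 1
  ext1 j
  rw [Real.closedBall_eq_Icc]
  congr 1 <;> ring

variable {c : Fin n → Fin 2} {u : (Fin n → ℝ) → ℝ≥0∞} {C : ℝ≥0} {ε : ℝ}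

theorem dyadicExpect_indicator {k k' : ℤ} (hk : k ≤ k') {z : Fin n → ℤ} {y : Fin n → ℝ}
    (hy : y ∈ dyadicCube c k z) :
    dyadicExpect c ((dyadicCube c k z).indicator u) k' y = dyadicExpect c u k' y := by
  have hsub : dyadicCube c k' (dyadicIndex c k' y) ⊆ dyadicCube c k z :=
    fun x hx => (dyadicIndex_eq_of_le hk hx).trans hy
  rw [dyadicExpect, dyadicExpect, setLAverage_eq, setLAverage_eq,
    setLIntegral_congr_fun (measurableSet_dyadicCube _ _ _)
      fun x hx => Set.indicator_of_mem (hsub hx) u]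

theorem tendsto_inv_two_zpow_div_two (k : ℤ) :
    Tendsto (fun N : ℕ => ((2 : ℝ) ^ (k + N))⁻¹ / 2) atTop (nhdsWithin 0 (Set.Ioi 0)) := by
  refine tendsto_nhdsWithin_iff.2 ⟨?_, Eventually.of_forall fun N => ?_⟩
  · have h := (tendsto_pow_atTop_nhds_zero_of_lt_one (r := (1 / 2 : ℝ)) (by norm_num)
      (by norm_num)).const_mul (((2 : ℝ) ^ k)⁻¹ / 2)
    rw [mul_zero] at h
    refine h.congr fun N => ?_
    rw [zpow_add₀ two_ne_zero, zpow_natCast, one_div, inv_pow, mul_inv]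
    ring
  · rw [Set.mem_Ioi]
    positivity

theorem ae_tendsto_dyadicExpect_of_lintegral_ne_top {f : (Fin n → ℝ) → ℝ≥0∞} (c : Fin n → Fin 2)
    (k : ℤ) (hf : AEMeasurable f) (hfin : ∫⁻ x, f x ≠ ∞) :
    ∀ᵐ y, Tendsto (fun N : ℕ => dyadicExpect c f (k + N) y) atTop (nhds (f y)) := by
  filter_upwards [VitaliFamily.ae_tendsto_lintegral_div
    (IsUnifLocDoublingMeasure.vitaliFamily (volume : Measure (Fin n → ℝ)) 1) hf hfin] with y hy
  let corner (N : ℕ) := dyadicCorner c (k + N) (dyadicIndex c (k + N) y)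
  have hball (N : ℕ) := cube_eq_closedBall (corner N) (l := (2 ^ (k + N))⁻¹) (by positivity)
  refine (hy.comp (IsUnifLocDoublingMeasure.tendsto_closedBall_filterAt volume
    (fun N j => corner N j + (2 ^ (k + N))⁻¹ / 2) _ (tendsto_inv_two_zpow_div_two k)
    (Eventually.of_forall fun N => ?_))).congr fun N => ?_
  · rw [one_mul, ← hball]
    exact dyadicCube_subset_cube _ _ _ (mem_dyadicCube_dyadicIndex c _ y)
  · rw [Function.comp_apply, ← hball, ← restrict_dyadicCube,
      ← measure_congr (dyadicCube_ae_eq_cube c _ _), ← setLAverage_eq]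
    rfl

theorem ae_tendsto_dyadicExpect (k : ℤ) (z : Fin n → ℤ) (hu : AEMeasurable u)
    (hfin : ∫⁻ x in dyadicCube c k z, u x ≠ ∞) :
    ∀ᵐ y, y ∈ dyadicCube c k z →
      Tendsto (fun N : ℕ => dyadicExpect c u (k + N) y) atTop (nhds (u y)) := by
  have hQ := measurableSet_dyadicCube c k z
  filter_upwards [ae_tendsto_dyadicExpect_of_lintegral_ne_top c k (hu.indicator hQ)
    (by rwa [lintegral_indicator hQ])] with y hy hyQ
  rw [Set.indicator_of_mem hyQ u] at hy
  exact hy.congr fun N => dyadicExpect_indicator (by lia) hyQ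

theorem volume_dyadicCube_eq_mul (k : ℤ) (z z' : Fin n → ℤ) :
    volume (dyadicCube c k z) = 2 ^ n * volume (dyadicCube c (k + 1) z') := by
  rw [volume_dyadicCube, volume_dyadicCube, ← mul_pow, ← ENNReal.ofReal_ofNat 2,
    ← ENNReal.ofReal_mul zero_le_two, zpow_add_one₀ two_ne_zero, mul_inv, mul_comm,
    inv_mul_cancel_right₀ two_ne_zero]

theorem setLIntegral_dyadicCube_eq_setLAverage_mul (k : ℤ) (z : Fin n → ℤ) :
    ∫⁻ x in dyadicCube c k z, u x =
      (⨍⁻ x in dyadicCube c k z, u x ∂volume) * volume (dyadicCube c k z) := by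
  rw [setLAverage_eq, ENNReal.div_mul_cancel (volume_dyadicCube_ne_zero c k z)
    (volume_dyadicCube_ne_top c k z)]

theorem setLIntegral_child_le (hA : AOneOn (dyadicGrid c) volume C u) {k : ℤ} {z z' : Fin n → ℤ}
    (hsub : dyadicCube c (k + 1) z' ⊆ dyadicCube c k z) :
    ∫⁻ x in dyadicCube c (k + 1) z', u x ≤
      (2 ^ n * C : ℝ≥0) * essInf u (volume.restrict (dyadicCube c k z)) *
        volume (dyadicCube c (k + 1) z') := by
  calc ∫⁻ x in dyadicCube c (k + 1) z', u x
      ≤ ∫⁻ x in dyadicCube c k z, u x := lintegral_mono_set hsub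
    _ ≤ C * essInf u (volume.restrict (dyadicCube c k z)) * volume (dyadicCube c k z) := by
      rw [setLIntegral_dyadicCube_eq_setLAverage_mul]
      gcongr
      exact hA _ (dyadicCube_mem_dyadicGrid c k z)
    _ = _ := by
      rw [volume_dyadicCube_eq_mul k z z']
      push_cast
      ring

theorem setLIntegral_dyadicExpect_rpow_add_le_self (hA : AOneOn (dyadicGrid c) volume C u)
    (hε : 0 ≤ ε) (k : ℤ) (z : Fin n → ℤ) :
    (∫⁻ x in dyadicCube c k z, dyadicExpect c u k x ^ (1 + ε)) +
      C ^ ε * (essInf u (volume.restrict (dyadicCube c k z)) ^ (1 + ε) *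
        volume (dyadicCube c k z)) ≤
    C ^ ε * (2 * essInf u (volume.restrict (dyadicCube c k z)) ^ ε *
      ∫⁻ x in dyadicCube c k z, u x) := by
  have hexpect : ∫⁻ y in dyadicCube c k z, dyadicExpect c u k y ^ (1 + ε) =
      (⨍⁻ x in dyadicCube c k z, u x ∂volume) ^ (1 + ε) * volume (dyadicCube c k z) := by
    rw [← setLIntegral_const]
    refine setLIntegral_congr_fun (measurableSet_dyadicCube _ _ _) fun y hy => ?_
    obtain rfl : dyadicIndex c k y = z := hy
    rfl
  have hinf := essInf_le_setLAverage (volume_dyadicCube_ne_zero c k z)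
    (volume_dyadicCube_ne_top c k z) u
  have hAQ := hA _ (dyadicCube_mem_dyadicGrid c k z)
  have hadd (s : ℝ≥0∞) : s ^ (1 + ε) = s * s ^ ε := by
    rw [ENNReal.rpow_add_of_nonneg _ _ zero_le_one hε, ENNReal.rpow_one]
  rw [hexpect, setLIntegral_dyadicCube_eq_setLAverage_mul k z]
  set V := volume (dyadicCube c k z)
  set m := essInf u (volume.restrict (dyadicCube c k z))
  set x := ⨍⁻ x in dyadicCube c k z, u x ∂volume
  calc x ^ (1 + ε) * V + C ^ ε * (m ^ (1 + ε) * V)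
      = x * x ^ ε * V + C ^ ε * (m * m ^ ε * V) := by rw [hadd, hadd]
    _ ≤ x * (C * m) ^ ε * V + C ^ ε * (x * m ^ ε * V) := by gcongr
    _ = C ^ ε * (2 * m ^ ε * (x * V)) := by
      rw [ENNReal.mul_rpow_of_nonneg _ _ hε]
      ring

theorem setLIntegral_dyadicExpect_rpow_add_le (hA : AOneOn (dyadicGrid c) volume C u)
    (hfin : ∀ k z, ∫⁻ x in dyadicCube c k z, u x ≠ ∞) (hε : 0 < ε) (hε1 : ε ≤ 1)
    (hCε : 2 * (2 ^ n * C * ε) ≤ 1) (N : ℕ) (k : ℤ) (z : Fin n → ℤ) :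
    (∫⁻ x in dyadicCube c k z, dyadicExpect c u (k + N) x ^ (1 + ε)) +
      C ^ ε * (essInf u (volume.restrict (dyadicCube c k z)) ^ (1 + ε) *
        volume (dyadicCube c k z)) ≤
    C ^ ε * (2 * essInf u (volume.restrict (dyadicCube c k z)) ^ ε *
      ∫⁻ x in dyadicCube c k z, u x) := by
  induction N generalizing k z with
  | zero => simpa using setLIntegral_dyadicExpect_rpow_add_le_self hA hε.le k z
  | succ N ih =>
    have hvol : volume (dyadicCube c k z) =
        ∑' z' : {z' // dyadicParent c k z' = z}, volume (dyadicCube c (k + 1) z') := by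
      simpa using setLIntegral_dyadicCube_eq_tsum c k z 1
    have hgen : k + ((N + 1 : ℕ) : ℤ) = k + 1 + N := by push_cast; ring
    rw [hvol, hgen, setLIntegral_dyadicCube_eq_tsum c k z, setLIntegral_dyadicCube_eq_tsum c k z u]
    simp_rw [← ENNReal.tsum_mul_left]
    rw [← ENNReal.tsum_add]
    refine ENNReal.tsum_le_tsum fun z' => ?_
    have hsub : dyadicCube c (k + 1) z' ⊆ dyadicCube c k z := by
      rw [dyadicCube_eq_iUnion_children c k z]
      exact Set.subset_iUnion (fun z' : {z' // dyadicParent c k z' = z} =>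
        dyadicCube c (k + 1) z') z'
    have hinf : essInf u (volume.restrict (dyadicCube c (k + 1) z')) ≠ ∞ := by
      refine ne_top_of_le_ne_top ?_ (essInf_le_setLAverage (volume_dyadicCube_ne_zero c _ _)
        (volume_dyadicCube_ne_top c _ _) u)
      exact (setLAverage_lt_top (hfin _ _)).ne
    exact add_mul_rpow_mul_le_of_le
      (essInf_antitone_measure (Measure.restrict_mono_set _ hsub).absolutelyContinuous) hinf
      (volume_dyadicCube_ne_top c _ _) (ENNReal.rpow_ne_top_of_nonneg hε.le ENNReal.coe_ne_top)
      (setLIntegral_child_le hA hsub) hε hε1 (by exact_mod_cast hCε) (ih (k + 1) z')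

theorem setLIntegral_rpow_le_liminf_dyadicExpect (hu : AEMeasurable u) {k : ℤ} {z : Fin n → ℤ}
    (hfin : ∫⁻ x in dyadicCube c k z, u x ≠ ∞) (s : ℝ) :
    ∫⁻ x in dyadicCube c k z, u x ^ s ≤
      liminf (fun N : ℕ => ∫⁻ x in dyadicCube c k z, dyadicExpect c u (k + N) x ^ s) atTop := by
  calc ∫⁻ x in dyadicCube c k z, u x ^ s
      = ∫⁻ x in dyadicCube c k z, liminf (fun N : ℕ => dyadicExpect c u (k + N) x ^ s) atTop := by
        refine setLIntegral_congr_fun_ae (measurableSet_dyadicCube c k z) ?_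
        filter_upwards [ae_tendsto_dyadicExpect k z hu hfin] with x hx hxQ
        exact (((ENNReal.continuous_rpow_const (y := s)).tendsto _).comp (hx hxQ)).liminf_eq.symm
    _ ≤ _ := lintegral_liminf_le fun N => (measurable_dyadicExpect c u _).pow_const _

theorem AOneOn.reverseHolder (hA : AOneOn (dyadicGrid c) volume C u) (hu : AEMeasurable u)
    (hfin : ∀ k z, ∫⁻ x in dyadicCube c k z, u x ≠ ∞) (hε : 0 < ε) (hε1 : ε ≤ 1)
    (hCε : 2 * (2 ^ n * C * ε) ≤ 1) :
    ReverseHolder (dyadicGrid c) volume (1 + ε) (2 * C ^ ε) u := by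
  rintro _ ⟨⟨k, z⟩, rfl⟩
  have hinf := essInf_le_setLAverage (volume_dyadicCube_ne_zero c k z)
    (volume_dyadicCube_ne_top c k z) u
  have hle : ∫⁻ x in dyadicCube c k z, u x ^ (1 + ε) ≤
      C ^ ε * (2 * essInf u (volume.restrict (dyadicCube c k z)) ^ ε *
        ∫⁻ x in dyadicCube c k z, u x) :=
    (setLIntegral_rpow_le_liminf_dyadicExpect hu (hfin k z) _).trans <|
      liminf_le_of_frequently_le' <| Frequently.of_forall fun N => le_self_add.trans <|
        setLIntegral_dyadicExpect_rpow_add_le hA hfin hε hε1 hCε N k z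
  calc ⨍⁻ x in dyadicCube c k z, u x ^ (1 + ε) ∂volume
      ≤ C ^ ε * (2 * (⨍⁻ x in dyadicCube c k z, u x ∂volume) ^ ε *
          ∫⁻ x in dyadicCube c k z, u x) / volume (dyadicCube c k z) := by
        rw [setLAverage_eq]
        gcongr
        exact hle.trans (by gcongr)
    _ = 2 * C ^ ε * ((⨍⁻ x in dyadicCube c k z, u x ∂volume) *
          (⨍⁻ x in dyadicCube c k z, u x ∂volume) ^ ε) := by
        nth_rw 2 [setLAverage_eq]
        simp only [div_eq_mul_inv]
        ring
    _ = (2 * C ^ ε : ℝ≥0) * (⨍⁻ x in dyadicCube c k z, u x ∂volume) ^ (1 + ε) := by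
        rw [ENNReal.rpow_add_of_nonneg _ _ zero_le_one hε.le, ENNReal.rpow_one, ENNReal.coe_mul,
          ENNReal.coe_rpow_of_nonneg _ hε.le]
        rfl

end AOne

section ApOn

variable {X : Type*} [MeasurableSpace X] {𝒬 : Set (Set X)} {μ : Measure X} {u r : X → ℝ≥0∞}
  {p q s : ℝ} {K L : ℝ≥0}

/-- The Muckenhoupt condition `A_q` with constant `L` for averages over the members of the
family `𝒬`. -/
def ApOn (𝒬 : Set (Set X)) (μ : Measure X) (q : ℝ) (L : ℝ≥0) (r : X → ℝ≥0∞) : Prop :=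
  ∀ Q ∈ 𝒬, (⨍⁻ x in Q, r x ∂μ) * (⨍⁻ x in Q, r x ^ (-1 / (q - 1)) ∂μ) ^ (q - 1) ≤ L

theorem ApOn.setLAverage_ne_top (hA : ApOn 𝒬 μ q L r) (hr : IsPositiveDensity μ r) (hq : 1 < q)
    {Q : Set X} (hQ : Q ∈ 𝒬) (hμQ₀ : μ Q ≠ 0) (hμQ : μ Q ≠ ∞) : ⨍⁻ x in Q, r x ∂μ ≠ ∞ := by
  have hr' := hr.rpow (-1 / (q - 1))
  intro htop
  have h := hA Q hQ
  rw [htop, ENNReal.top_mul, top_le_iff] at h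
  · exact ENNReal.coe_ne_top h
  · rw [Ne, ENNReal.rpow_eq_zero_iff_of_pos (by linarith)]
    exact setLAverage_ne_zero hμQ₀ hμQ hr'.aemeasurable hr'.ne_zero

theorem lintegral_rpow_mul_rpow_le (hu : AEMeasurable u μ) (hr : AEMeasurable r μ) (hp : 1 < p)
    (hq : 1 < q) (hs : 0 < s) (hpqs : p / s + (p - 1) * (q - 1) = 1)
    (hK : ∫⁻ x, u x ^ s ∂μ ≤ K * (∫⁻ x, u x ∂μ) ^ s)
    (hL : (∫⁻ x, r x ∂μ) * (∫⁻ x, r x ^ (-1 / (q - 1)) ∂μ) ^ (q - 1) ≤ L) :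
    (∫⁻ x, u x ^ p * r x ^ (1 - p) ∂μ) * (∫⁻ x, r x ∂μ) ^ (p - 1) ≤
      (K ^ (p / s) * L ^ (p - 1) : ℝ≥0) * (∫⁻ x, u x ∂μ) ^ p := by
  have hp0 : 0 < p := by linarith
  have hp1 : 0 < p - 1 := by linarith
  have hq1 : 0 < q - 1 := by linarith
  have hps : 0 < p / s := by positivity
  have hconj : (s / p).HolderConjugate (1 / ((p - 1) * (q - 1))) := by
    have : 0 < (p - 1) * (q - 1) := by positivity
    rw [Real.holderConjugate_iff, lt_div_iff₀ hp0, one_mul, ← div_lt_one hs, inv_div, one_div,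
      inv_inv]
    exact ⟨by linarith, hpqs⟩
  have hHolder := ENNReal.lintegral_mul_le_Lp_mul_Lq μ hconj (hu.pow_const p)
    (hr.pow_const (1 - p))
  have hexp : p * (s / p) = s := by field_simp
  have hexp' : (1 - p) * (1 / ((p - 1) * (q - 1))) = -1 / (q - 1) := by field_simp; ring
  simp only [← ENNReal.rpow_mul, Pi.mul_apply, hexp, hexp', one_div_div, div_one] at hHolder
  calc (∫⁻ x, u x ^ p * r x ^ (1 - p) ∂μ) * (∫⁻ x, r x ∂μ) ^ (p - 1)
      ≤ (∫⁻ x, u x ^ s ∂μ) ^ (p / s) * (∫⁻ x, r x ^ (-1 / (q - 1)) ∂μ) ^ ((p - 1) * (q - 1)) *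
        (∫⁻ x, r x ∂μ) ^ (p - 1) := by gcongr
    _ = (∫⁻ x, u x ^ s ∂μ) ^ (p / s) * ((∫⁻ x, r x ∂μ) *
        (∫⁻ x, r x ^ (-1 / (q - 1)) ∂μ) ^ (q - 1)) ^ (p - 1) := by
      rw [ENNReal.mul_rpow_of_nonneg _ _ hp1.le, ← ENNReal.rpow_mul, mul_comm (q - 1)]
      ring
    _ ≤ (K * (∫⁻ x, u x ∂μ) ^ s) ^ (p / s) * L ^ (p - 1) := by gcongr
    _ = (K ^ (p / s) * L ^ (p - 1) : ℝ≥0) * (∫⁻ x, u x ∂μ) ^ p := by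
      rw [ENNReal.mul_rpow_of_nonneg _ _ hps.le, ← ENNReal.rpow_mul, mul_div_cancel₀ _ hs.ne',
        ENNReal.coe_mul, ENNReal.coe_rpow_of_nonneg _ hps.le, ENNReal.coe_rpow_of_nonneg _ hp1.le]
      ring

theorem IsPositiveDensity.div_withDensity (hu : IsPositiveDensity μ u)
    (hr : IsPositiveDensity μ r) : IsPositiveDensity (μ.withDensity r) fun x => u x / r x := by
  have hac := withDensity_absolutelyContinuous μ r
  refine ⟨(hu.aemeasurable.div hr.aemeasurable).mono_ac hac, hac.ae_le ?_, hac.ae_le ?_⟩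
  · filter_upwards [hu.ne_zero, hr.ne_top] with x hux hrx using ENNReal.div_ne_zero.2 ⟨hux, hrx⟩
  · filter_upwards [hu.ne_top, hr.ne_zero] with x hux hrx using ENNReal.div_ne_top hux hrx

theorem IsPositiveDensity.withDensity_withDensity_div (hu : IsPositiveDensity μ u)
    (hr : IsPositiveDensity μ r) :
    (μ.withDensity r).withDensity (fun x => u x / r x) = μ.withDensity u := by
  have hdiv : AEMeasurable (fun x => u x / r x) μ := hu.aemeasurable.div hr.aemeasurable
  rw [← withDensity_mul₀ hr.aemeasurable hdiv]
  refine withDensity_congr_ae ?_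
  filter_upwards [hr.ne_zero, hr.ne_top] with x hrx₀ hrx using ENNReal.mul_div_cancel hrx₀ hrx

theorem ReverseHolder.div_withDensity (hRH : ReverseHolder 𝒬 μ s K u) (hA : ApOn 𝒬 μ q L r)
    (h𝒬 : ∀ Q ∈ 𝒬, MeasurableSet Q) (hμ₀ : ∀ Q ∈ 𝒬, μ Q ≠ 0) (hμ : ∀ Q ∈ 𝒬, μ Q ≠ ∞)
    (hu : IsPositiveDensity μ u) (hr : IsPositiveDensity μ r) (hp : 1 < p) (hq : 1 < q)
    (hs : 0 < s) (hpqs : p / s + (p - 1) * (q - 1) = 1) :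
    ReverseHolder 𝒬 (μ.withDensity r) p (K ^ (p / s) * L ^ (p - 1)) fun x => u x / r x := by
  intro Q hQ
  have hb₀ := setLAverage_ne_zero (hμ₀ Q hQ) (hμ Q hQ) hr.aemeasurable hr.ne_zero
  have hb := hA.setLAverage_ne_top hr hq hQ (hμ₀ Q hQ) (hμ Q hQ)
  have hHolder : (⨍⁻ x in Q, u x ^ p * r x ^ (1 - p) ∂μ) * (⨍⁻ x in Q, r x ∂μ) ^ (p - 1) ≤
      (K ^ (p / s) * L ^ (p - 1) : ℝ≥0) * (⨍⁻ x in Q, u x ∂μ) ^ p :=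
    lintegral_rpow_mul_rpow_le (hu.aemeasurable.restrict.smul_measure _)
      (hr.aemeasurable.restrict.smul_measure _) hp hq hs hpqs (hRH Q hQ) (hA Q hQ)
  have hcancel : ⨍⁻ x in Q, r x * (u x / r x) ∂μ = ⨍⁻ x in Q, u x ∂μ := by
    refine laverage_congr (ae_restrict_of_ae ?_)
    filter_upwards [hr.ne_zero, hr.ne_top] with x hrx₀ hrx using ENNReal.mul_div_cancel hrx₀ hrx
  have hcancel_rpow : ⨍⁻ x in Q, r x * (u x / r x) ^ p ∂μ =
      ⨍⁻ x in Q, u x ^ p * r x ^ (1 - p) ∂μ := by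
    refine laverage_congr (ae_restrict_of_ae ?_)
    filter_upwards [hr.ne_zero, hr.ne_top] with x hrx₀ hrx
    rw [ENNReal.div_rpow_of_nonneg _ _ (by linarith), ENNReal.rpow_sub _ _ hrx₀ hrx,
      ENNReal.rpow_one, div_eq_mul_inv, div_eq_mul_inv]
    ring
  rw [hr.setLAverage_withDensity_eq (h𝒬 Q hQ) (hμ₀ Q hQ) (hμ Q hQ),
    hr.setLAverage_withDensity_eq (h𝒬 Q hQ) (hμ₀ Q hQ) (hμ Q hQ), hcancel, hcancel_rpow,
    ENNReal.div_rpow_of_nonneg _ _ (by linarith)]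
  set b := ⨍⁻ x in Q, r x ∂μ
  have hbp₀ : b ^ (p - 1) ≠ 0 := by simp [ENNReal.rpow_eq_zero_iff, hb₀, hb]
  have hbp : b ^ (p - 1) ≠ ∞ := by simp [ENNReal.rpow_eq_top_iff, hb₀, hb]
  rw [← mul_div_assoc, ← rpow_sub_one_mul_self hb₀ hb p,
    ← ENNReal.mul_div_mul_right _ b hbp₀ hbp, mul_comm b]
  gcongr

theorem exists_div_add_sub_one_mul_sub_one_eq_one (hq : 1 < q) (hs : 1 < s) :
    ∃ p, 1 < p ∧ p / s + (p - 1) * (q - 1) = 1 := by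
  have hden : 0 < (q - 1) + 1 / s := by
    have : 0 < 1 / s := by positivity
    linarith
  refine ⟨q / ((q - 1) + 1 / s), ?_, ?_⟩
  · rw [lt_div_iff₀ hden]
    linarith [(div_lt_one (by linarith)).2 hs]
  · calc q / ((q - 1) + 1 / s) / s + (q / ((q - 1) + 1 / s) - 1) * (q - 1)
        = q / ((q - 1) + 1 / s) * ((q - 1) + 1 / s) - (q - 1) := by ring
      _ = 1 := by rw [div_mul_cancel₀ _ hden.ne']; ring

theorem ReverseHolder.exists_weakNorm_div_mul_familyMaximal_le (hRH : ReverseHolder 𝒬 μ s K u)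
    (hA : ApOn 𝒬 μ q L r) (h𝒬 : IsNestedFamily 𝒬) (hμ₀ : ∀ Q ∈ 𝒬, μ Q ≠ 0)
    (hμ : ∀ Q ∈ 𝒬, μ Q ≠ ∞) (hu : IsPositiveDensity μ u) (hr : IsPositiveDensity μ r)
    (hutop : ∀ Q ∈ 𝒬, ⨍⁻ x in Q, u x ∂μ ≠ ∞) (hs : 1 < s) (hq : 1 < q) :
    ∃ K' : ℝ≥0, ∀ h : X → ℝ≥0∞, weakNorm 1 (μ.withDensity r)
      (fun x => u x / r x * familyMaximal 𝒬 (μ.withDensity u) h x) ≤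
        K' * ∫⁻ x, u x * h x ∂μ := by
  obtain ⟨p, hp, hpqs⟩ := exists_div_add_sub_one_mul_sub_one_eq_one hq hs
  have hrQ (Q) (hQ : Q ∈ 𝒬) :
      μ.withDensity r Q = (⨍⁻ x in Q, r x ∂μ) * μ Q := by
    rw [withDensity_apply _ (h𝒬.measurableSet Q hQ), setLAverage_eq,
      ENNReal.div_mul_cancel (hμ₀ Q hQ) (hμ Q hQ)]
  have hr₀ (Q) (hQ : Q ∈ 𝒬) :=
    setLAverage_ne_zero (hμ₀ Q hQ) (hμ Q hQ) hr.aemeasurable hr.ne_zero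
  have hrtop (Q) (hQ : Q ∈ 𝒬) := hA.setLAverage_ne_top hr hq hQ (hμ₀ Q hQ) (hμ Q hQ)
  have hcancel (f : X → ℝ≥0∞) : ∀ᵐ x ∂μ, r x * (u x / r x * f x) = u x * f x := by
    filter_upwards [hr.ne_zero, hr.ne_top] with x hrx₀ hrx
    rw [← mul_assoc, ENNReal.mul_div_cancel hrx₀ hrx]
  have hWtop (Q) (hQ : Q ∈ 𝒬) : ⨍⁻ x in Q, u x / r x ∂(μ.withDensity r) ≠ ∞ := by
    have hcongr := laverage_congr (ae_restrict_of_ae (s := Q) (hcancel 1))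
    simp only [Pi.one_apply, mul_one] at hcongr
    rw [hr.setLAverage_withDensity_eq (h𝒬.measurableSet Q hQ) (hμ₀ Q hQ) (hμ Q hQ), hcongr]
    exact ENNReal.div_ne_top (hutop Q hQ) (hr₀ Q hQ)
  obtain ⟨K', hK'⟩ := (hRH.div_withDensity hA h𝒬.measurableSet hμ₀ hμ hu hr hp hq (by linarith)
    hpqs).exists_weakNorm_mul_familyMaximal_le h𝒬
      (fun Q hQ => hrQ Q hQ ▸ mul_ne_zero (hr₀ Q hQ) (hμ₀ Q hQ))
      (fun Q hQ => hrQ Q hQ ▸ ENNReal.mul_ne_top (hrtop Q hQ) (hμ Q hQ))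
      (hu.div_withDensity hr) hWtop hp
  refine ⟨K', fun h => ?_⟩
  rw [← hu.withDensity_withDensity_div hr]
  refine (hK' h).trans_eq ?_
  rw [← setLIntegral_univ, hr.setLIntegral_withDensity_eq .univ, setLIntegral_univ,
    lintegral_congr_ae (hcancel h)]

end ApOn

section Multilinear

variable {n m : ℕ} {w : Fin m → (Fin n → ℝ) → ℝ≥0∞} {v : (Fin n → ℝ) → ℝ≥0∞}
  {𝒬 : Set (Set (Fin n → ℝ))} {μ : Measure (Fin n → ℝ)} {Q : Set (Fin n → ℝ)} {C : ℝ≥0}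

theorem IsWeight.isPositiveDensity {u : (Fin n → ℝ) → ℝ≥0∞} (hu : IsWeight u) :
    IsPositiveDensity volume u :=
  ⟨hu.aemeasurable, hu.pos.mono fun _ hx => hx.ne', hu.lt_top.mono fun _ hx => hx.ne⟩

theorem isPositiveDensity_nu (hw : ∀ i, IsPositiveDensity μ (w i)) :
    IsPositiveDensity μ (nu w) where
  aemeasurable := by
    unfold nu
    exact Finset.aemeasurable_fun_prod _ fun i _ => (hw i).aemeasurable.pow_const _
  ne_zero := by
    filter_upwards [ae_all_iff.2 fun i => ((hw i).rpow (1 / m)).ne_zero] with x hx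
    exact Finset.prod_ne_zero_iff.2 fun i _ => hx i
  ne_top := by
    filter_upwards [ae_all_iff.2 fun i => ((hw i).rpow (1 / m)).ne_top] with x hx
    exact ENNReal.prod_ne_top fun i _ => hx i

theorem essInf_restrict_ne_top {X : Type*} [MeasurableSpace X] {μ : Measure X} {Q : Set X}
    (hμQ : μ Q ≠ 0) {u : X → ℝ≥0∞} (hu : ∀ᵐ x ∂μ, u x ≠ ∞) : essInf u (μ.restrict Q) ≠ ∞ := by
  have : NeZero (μ.restrict Q) := ⟨mt Measure.restrict_eq_zero.1 hμQ⟩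
  have hle : ∀ᵐ x ∂μ.restrict Q, essInf u (μ.restrict Q) ≤ u x := ae_essInf_le
  obtain ⟨x, hux, hlex⟩ := ((ae_restrict_of_ae hu).and hle).exists
  exact ne_top_of_le_ne_top hux hlex

theorem prod_essInf_rpow_le_essInf_nu (w : Fin m → (Fin n → ℝ) → ℝ≥0∞)
    (μ : Measure (Fin n → ℝ)) : (∏ i, essInf (w i) μ) ^ (1 / (m : ℝ)) ≤ essInf (nu w) μ := by
  rw [← ENNReal.prod_rpow_of_nonneg (by positivity)]
  refine le_essInf_of_ae_le _ ?_
  filter_upwards [ae_all_iff.2 fun i => ae_essInf_le (f := w i) (μ := μ)] with x hx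
  exact Finset.prod_le_prod' fun i _ => ENNReal.rpow_le_rpow (hx i) (by positivity)

theorem essInf_mul_setLAverage_le {X : Type*} [MeasurableSpace X] {μ : Measure X} {Q : Set X}
    {u : X → ℝ≥0∞} (hu : essInf u (μ.restrict Q) ≠ ∞) (g : X → ℝ≥0∞) :
    essInf u (μ.restrict Q) * ⨍⁻ x in Q, g x ∂μ ≤ ⨍⁻ x in Q, g x * u x ∂μ := by
  rw [setLAverage_eq, setLAverage_eq, ← mul_div_assoc, ← lintegral_const_mul' _ _ hu]
  gcongr ?_ / _
  refine lintegral_mono_ae ?_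
  filter_upwards [ae_essInf_le (f := u) (μ := μ.restrict Q)] with x hx
  rw [mul_comm]
  gcongr

/-- The multilinear condition `A_{(1, …, 1)}` with constant `C` over the members of the family `𝒬`,
written without inverses of the essential infima. -/
def AOneVecOn (𝒬 : Set (Set (Fin n → ℝ))) (μ : Measure (Fin n → ℝ)) (C : ℝ≥0)
    (w : Fin m → (Fin n → ℝ) → ℝ≥0∞) : Prop :=
  ∀ Q ∈ 𝒬, (⨍⁻ x in Q, nu w x ∂μ) ^ m ≤ C * ∏ i, essInf (w i) (μ.restrict Q)

theorem AOneVecOn.setLAverage_nu_le (hA : AOneVecOn 𝒬 μ C w) (hm : 0 < m) (hQ : Q ∈ 𝒬) :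
    ⨍⁻ x in Q, nu w x ∂μ ≤
      (C ^ (1 / (m : ℝ)) : ℝ≥0) * (∏ i, essInf (w i) (μ.restrict Q)) ^ (1 / (m : ℝ)) := by
  have hm₀ : (0 : ℝ) < 1 / m := by positivity
  rw [ENNReal.coe_rpow_of_nonneg _ hm₀.le, ← ENNReal.mul_rpow_of_nonneg _ _ hm₀.le,
    one_div, ENNReal.le_rpow_inv_iff (by positivity), ENNReal.rpow_natCast]
  exact hA Q hQ

theorem AOneVecOn.aOneOn (hA : AOneVecOn 𝒬 μ C w) (hm : 0 < m) :
    AOneOn 𝒬 μ (C ^ (1 / (m : ℝ))) (nu w) := fun Q hQ => by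
  grw [hA.setLAverage_nu_le hm hQ, prod_essInf_rpow_le_essInf_nu]

theorem AOneVecOn.setLAverage_nu_ne_top (hA : AOneVecOn 𝒬 μ C w) (hm : 0 < m)
    (hw : ∀ i, ∀ᵐ x ∂μ, w i x ≠ ∞) (hQ : Q ∈ 𝒬) (hμQ : μ Q ≠ 0) :
    ⨍⁻ x in Q, nu w x ∂μ ≠ ∞ := by
  refine ne_top_of_le_ne_top (ENNReal.mul_ne_top ENNReal.coe_ne_top ?_)
    (hA.setLAverage_nu_le hm hQ)
  exact ENNReal.rpow_ne_top_of_nonneg (by positivity)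
    (ENNReal.prod_ne_top fun i _ => essInf_restrict_ne_top hμQ (hw i))

theorem AOneVecOn.prod_setLAverage_le (hA : AOneVecOn 𝒬 μ C w) (hm : 0 < m)
    (hw : ∀ i, IsPositiveDensity μ (w i)) (hQ : Q ∈ 𝒬) (hQm : MeasurableSet Q) (hμQ₀ : μ Q ≠ 0)
    (hμQ : μ Q ≠ ∞) (g : Fin m → (Fin n → ℝ) → ℝ≥0∞) :
    ∏ i, ⨍⁻ x in Q, g i x ∂μ ≤
      C * ∏ i, ⨍⁻ x in Q, g i x * w i x / nu w x ∂(μ.withDensity (nu w)) := by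
  have hν := isPositiveDensity_nu hw
  have hν₀ := setLAverage_ne_zero hμQ₀ hμQ hν.aemeasurable hν.ne_zero
  have hνtop := hA.setLAverage_nu_ne_top hm (fun i => (hw i).ne_top) hQ hμQ₀
  have haverage (i) : ⨍⁻ x in Q, g i x * w i x / nu w x ∂(μ.withDensity (nu w)) =
      (⨍⁻ x in Q, g i x * w i x ∂μ) / ⨍⁻ x in Q, nu w x ∂μ := by
    rw [hν.setLAverage_withDensity_eq hQm hμQ₀ hμQ]
    congr 1
    refine laverage_congr (ae_restrict_of_ae ?_)
    filter_upwards [hν.ne_zero, hν.ne_top] with x h₀ htop using ENNReal.mul_div_cancel h₀ htop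
  simp_rw [haverage]
  simp only [div_eq_mul_inv, Finset.prod_mul_distrib, Finset.prod_const, Finset.card_univ,
    Fintype.card_fin, ← ENNReal.inv_pow]
  rw [← mul_assoc, ← div_eq_mul_inv, ENNReal.le_div_iff_mul_le (.inl (pow_ne_zero _ hν₀))
    (.inl (ENNReal.pow_ne_top hνtop))]
  calc (∏ i, ⨍⁻ x in Q, g i x ∂μ) * (⨍⁻ x in Q, nu w x ∂μ) ^ m
      ≤ (∏ i, ⨍⁻ x in Q, g i x ∂μ) * (C * ∏ i, essInf (w i) (μ.restrict Q)) := by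
        gcongr
        exact hA Q hQ
    _ = C * ∏ i, essInf (w i) (μ.restrict Q) * ⨍⁻ x in Q, g i x ∂μ := by
        rw [Finset.prod_mul_distrib]
        ring
    _ ≤ C * ∏ i, ⨍⁻ x in Q, g i x * w i x ∂μ := by
        gcongr with i
        exact essInf_mul_setLAverage_le (essInf_restrict_ne_top hμQ₀ (hw i).ne_top) (g i)

theorem MemAOneVec.exists_aOneVecOn_dyadicGrid (hw : MemAOneVec w) :
    ∃ C : ℝ≥0, ∀ c, AOneVecOn (dyadicGrid c) volume C w := by
  obtain ⟨hwW, C, hC⟩ := hw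
  refine ⟨C, ?_⟩
  rintro c _ ⟨⟨k, z⟩, rfl⟩
  have htop (i) := essInf_restrict_ne_top (volume_dyadicCube_ne_zero c k z)
    (hwW i).isPositiveDensity.ne_top
  have hle := hC (dyadicCorner c k z) (2 ^ k)⁻¹ (by positivity)
  rw [avg_dyadicCorner, ← restrict_dyadicCube,
    ← ENNReal.prod_inv_distrib fun i _ j _ _ => .inr (htop j), ← div_eq_mul_inv] at hle
  rwa [ENNReal.div_le_iff_le_mul (.inr ENNReal.coe_ne_top)
    (.inl (ENNReal.prod_ne_top fun i _ => htop i))] at hle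

theorem MemAp.exists_apOn_dyadicGrid {p : ℝ} {r : (Fin n → ℝ) → ℝ≥0∞} (hr : MemAp p r) :
    ∃ L : ℝ≥0, ∀ c, ApOn (dyadicGrid c) volume p L r := by
  obtain ⟨-, L, hL⟩ := hr
  refine ⟨L, ?_⟩
  rintro c _ ⟨⟨k, z⟩, rfl⟩
  have hle := hL (dyadicCorner c k z) (2 ^ k)⁻¹ (by positivity)
  rwa [avg_dyadicCorner, avg_dyadicCorner] at hle

theorem AOneOn.exists_weakNorm_div_mul_familyMaximal_le {c : Fin n → Fin 2} {q : ℝ} {L : ℝ≥0}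
    {u r : (Fin n → ℝ) → ℝ≥0∞} (hA : AOneOn (dyadicGrid c) volume C u)
    (hAp : ApOn (dyadicGrid c) volume q L r) (hu : IsPositiveDensity volume u)
    (hr : IsPositiveDensity volume r) (hutop : ∀ Q ∈ dyadicGrid c, ⨍⁻ x in Q, u x ∂volume ≠ ∞)
    (hq : 1 < q) :
    ∃ K : ℝ≥0, ∀ h : (Fin n → ℝ) → ℝ≥0∞, weakNorm 1 (volume.withDensity r)
      (fun x => u x / r x * familyMaximal (dyadicGrid c) (volume.withDensity u) h x) ≤
        K * ∫⁻ x, u x * h x := by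
  have hfin (k : ℤ) (z : Fin n → ℤ) : ∫⁻ x in dyadicCube c k z, u x ≠ ∞ := by
    rw [setLIntegral_dyadicCube_eq_setLAverage_mul]
    exact ENNReal.mul_ne_top (hutop _ (dyadicCube_mem_dyadicGrid c k z))
      (volume_dyadicCube_ne_top c k z)
  have hε : (0 : ℝ) < 1 / (2 * 2 ^ n * C + 1) := by positivity
  have hε1 : 1 / (2 * 2 ^ n * C + 1) ≤ (1 : ℝ) :=
    (div_le_one (by positivity)).2 (le_add_of_nonneg_left (by positivity))
  have hCε : 2 * (2 ^ n * C * (1 / (2 * 2 ^ n * C + 1))) ≤ (1 : ℝ) := by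
    rw [← mul_assoc, mul_one_div, div_le_one (by positivity)]
    linarith
  have hvol₀ : ∀ Q ∈ dyadicGrid c, volume Q ≠ 0 := by
    rintro _ ⟨⟨k, z⟩, rfl⟩
    exact volume_dyadicCube_ne_zero c k z
  have hvol : ∀ Q ∈ dyadicGrid c, volume Q ≠ ∞ := by
    rintro _ ⟨⟨k, z⟩, rfl⟩
    exact volume_dyadicCube_ne_top c k z
  exact (hA.reverseHolder hu.aemeasurable hfin hε hε1 hCε).exists_weakNorm_div_mul_familyMaximal_le
    hAp (isNestedFamily_dyadicGrid c) hvol₀ hvol hu hr hutop (lt_add_of_pos_right 1 hε) hq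

/-- The multilinear maximal function of a tuple of functions with values in `[0, ∞]`;
`multiMaximal f` is its value at the tuple of the `‖f i ·‖ₑ`. -/
def prodMaximal (g : Fin m → (Fin n → ℝ) → ℝ≥0∞) (x : Fin n → ℝ) : ℝ≥0∞ :=
  ⨆ (a : Fin n → ℝ) (l : ℝ) (_ : 0 < l) (_ : x ∈ cube a l), ∏ i, avg a l (g i)

theorem prodMaximal_le_iSup_prod_familyMaximal (hm : 0 < m)
    (hA : ∀ c, AOneVecOn (dyadicGrid c) volume C w) (hw : ∀ i, IsPositiveDensity volume (w i))
    (g : Fin m → (Fin n → ℝ) → ℝ≥0∞) (x : Fin n → ℝ) :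
    prodMaximal g x ≤ (6 ^ (n * m) * C : ℝ≥0) * ⨆ c, ∏ i, familyMaximal (dyadicGrid c)
      (volume.withDensity (nu w)) (fun y => g i y * w i y / nu w y) x := by
  simp only [prodMaximal, iSup_le_iff]
  intro a l hl hx
  obtain ⟨c, k, z, hsub, hkl⟩ := exists_cube_subset_dyadicCube a hl
  have hQ := dyadicCube_mem_dyadicGrid c k z
  calc ∏ i, avg a l (g i)
      ≤ ∏ i, 6 ^ n * ⨍⁻ y in dyadicCube c k z, g i y ∂volume :=
        Finset.prod_le_prod' fun i _ => avg_le_setLAverage_dyadicCube hsub hkl (g i)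
    _ = 6 ^ (n * m) * ∏ i, ⨍⁻ y in dyadicCube c k z, g i y ∂volume := by
        rw [Finset.prod_mul_distrib, Finset.prod_const, Finset.card_univ, Fintype.card_fin,
          ← pow_mul]
    _ ≤ 6 ^ (n * m) * (C * ∏ i, ⨍⁻ y in dyadicCube c k z, g i y * w i y / nu w y
          ∂(volume.withDensity (nu w))) := by
        gcongr
        exact (hA c).prod_setLAverage_le hm hw hQ (measurableSet_dyadicCube c k z)
          (volume_dyadicCube_ne_zero c k z) (volume_dyadicCube_ne_top c k z) g
    _ = (6 ^ (n * m) * C : ℝ≥0) * ∏ i, ⨍⁻ y in dyadicCube c k z, g i y * w i y / nu w y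
          ∂(volume.withDensity (nu w)) := by
        push_cast
        ring
    _ ≤ _ := by
        gcongr
        refine le_iSup_of_le c (Finset.prod_le_prod' fun i _ => ?_)
        exact setLAverage_le_familyMaximal hQ (hsub hx)

theorem div_mul_rpow_one_div_pow {a : ℝ≥0∞} (ha₀ : a ≠ 0) (ha : a ≠ ∞) (b : ℝ≥0∞) (hm : 0 < m) :
    (a / (a * b ^ (1 / (m : ℝ)))) ^ m = b⁻¹ := by
  have hcancel := ENNReal.mul_div_mul_left 1 (b ^ (1 / (m : ℝ))) ha₀ ha
  rw [mul_one] at hcancel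
  rw [hcancel, one_div (b ^ _), ← ENNReal.inv_pow, ← ENNReal.rpow_natCast, ← ENNReal.rpow_mul,
    one_div_mul_cancel (by positivity), ENNReal.rpow_one]

theorem prodMaximal_div_le_iSup_prod (hm : 0 < m) (hA : ∀ c, AOneVecOn (dyadicGrid c) volume C w)
    (hw : ∀ i, IsPositiveDensity volume (w i)) (g : Fin m → (Fin n → ℝ) → ℝ≥0∞)
    {x : Fin n → ℝ} (hν₀ : nu w x ≠ 0) (hν : nu w x ≠ ∞) :
    prodMaximal g x / v x ≤ (6 ^ (n * m) * C : ℝ≥0) * ⨆ c, ∏ i,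
      nu w x / (nu w x * v x ^ (1 / (m : ℝ))) * familyMaximal (dyadicGrid c)
        (volume.withDensity (nu w)) (fun y => g i y * w i y / nu w y) x := by
  simp only [Finset.prod_mul_distrib, Finset.prod_const, Finset.card_univ, Fintype.card_fin,
    div_mul_rpow_one_div_pow hν₀ hν _ hm, ← ENNReal.mul_iSup]
  rw [div_eq_mul_inv, mul_comm _ (v x)⁻¹, mul_left_comm]
  gcongr
  exact prodMaximal_le_iSup_prod_familyMaximal hm hA hw g x

theorem MemAOneVec.exists_weakNorm_div_mul_familyMaximal_le (hw : MemAOneVec w) (hm : 0 < m)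
    {q : ℝ} {r : (Fin n → ℝ) → ℝ≥0∞} (hr : MemAp q r) (hq : 1 < q) :
    ∃ K : ℝ≥0, ∀ c (h : (Fin n → ℝ) → ℝ≥0∞), weakNorm 1 (volume.withDensity r)
      (fun x => nu w x / r x * familyMaximal (dyadicGrid c) (volume.withDensity (nu w)) h x) ≤
        K * ∫⁻ x, nu w x * h x := by
  obtain ⟨C, hC⟩ := hw.exists_aOneVecOn_dyadicGrid
  obtain ⟨L, hL⟩ := hr.exists_apOn_dyadicGrid
  have hwp (i) := (hw.1 i).isPositiveDensity
  have htop (c) : ∀ Q ∈ dyadicGrid c, ⨍⁻ x in Q, nu w x ∂volume ≠ ∞ := by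
    rintro _ ⟨⟨k, z⟩, rfl⟩
    exact (hC c).setLAverage_nu_ne_top hm (fun i => (hwp i).ne_top)
      (dyadicCube_mem_dyadicGrid c k z) (volume_dyadicCube_ne_zero c k z)
  choose K hK using fun c => ((hC c).aOneOn hm).exists_weakNorm_div_mul_familyMaximal_le (hL c)
    (isPositiveDensity_nu hwp) hr.1.isPositiveDensity (htop c) hq
  refine ⟨∑ c, K c, fun c h => (hK c h).trans ?_⟩
  gcongr
  exact Finset.single_le_sum (fun _ _ => zero_le) (Finset.mem_univ c)

theorem weakNorm_iSup_prod_le (hm : 0 < m) {X ι : Type*} [Fintype ι] [MeasurableSpace X]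
    {ρ : Measure X} {K : ℝ≥0} {I : Fin m → ℝ≥0∞} {F : ι → Fin m → X → ℝ≥0∞}
    (hF : ∀ c i, weakNorm 1 ρ (F c i) ≤ K * I i) :
    weakNorm (1 / m) ρ (fun x => ⨆ c, ∏ i, F c i x) ≤
      ((Fintype.card ι * m * K) ^ m : ℝ≥0) * ∏ i, I i := by
  have : Nonempty (Fin m) := Fin.pos_iff_nonempty.1 hm
  have hprod (c) : weakNorm (1 / m) ρ (fun x => ∏ i, F c i x) ≤ m ^ m * ∏ i, K * I i := by
    refine le_trans (by simpa using weakNorm_prod_le (μ := ρ) (F c)) ?_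
    gcongr with i
    exact hF c i
  refine (weakNorm_iSup_le (by positivity) hprod).trans_eq ?_
  rw [one_div_one_div, ENNReal.rpow_natCast, Finset.prod_mul_distrib, Finset.prod_const,
    Finset.card_univ, Fintype.card_fin]
  push_cast
  ring

end Multilinear

end MixedWeak

end

theorem mainTheorem2_general {n m : ℕ} (hm : 0 < m) (w : Fin m → (Fin n → ℝ) → ℝ≥0∞)
    (v : (Fin n → ℝ) → ℝ≥0∞) (hw : MixedWeak.MemAOneVec w)
    (hnuv : MixedWeak.MemAInfty (fun x => MixedWeak.nu w x * v x ^ (1 / (m : ℝ)))) :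
    ∃ C : ℝ≥0, ∀ g : Fin m → (Fin n → ℝ) → ℝ≥0∞,
      MixedWeak.weakNorm (1 / (m : ℝ))
          (volume.withDensity (fun x => MixedWeak.nu w x * v x ^ (1 / (m : ℝ))))
          (fun x => MixedWeak.prodMaximal g x / v x) ≤
        C * ∏ i, ∫⁻ x, g i x * w i x := by
  obtain ⟨q, hq, hr⟩ := hnuv
  obtain ⟨C, hC⟩ := hw.exists_aOneVecOn_dyadicGrid
  obtain ⟨K, hK⟩ := hw.exists_weakNorm_div_mul_familyMaximal_le hm hr hq
  have hwp (i) := (hw.1 i).isPositiveDensity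
  have hν := MixedWeak.isPositiveDensity_nu hwp
  refine ⟨6 ^ (n * m) * C * (Fintype.card (Fin n → Fin 2) * m * K) ^ m, fun g => ?_⟩
  have hint (i) : ∫⁻ x, MixedWeak.nu w x * (g i x * w i x / MixedWeak.nu w x) =
      ∫⁻ x, g i x * w i x := by
    refine lintegral_congr_ae ?_
    filter_upwards [hν.ne_zero, hν.ne_top] with x h₀ htop using ENNReal.mul_div_cancel h₀ htop
  have hpointwise := (withDensity_absolutelyContinuous volume
    (fun x => MixedWeak.nu w x * v x ^ (1 / (m : ℝ)))).ae_le <| by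
      filter_upwards [hν.ne_zero, hν.ne_top] with x h₀ htop using
        MixedWeak.prodMaximal_div_le_iSup_prod (v := v) hm hC hwp g h₀ htop
  refine (MixedWeak.weakNorm_mono_ae (by positivity) hpointwise).trans <|
    (MixedWeak.weakNorm_const_mul_le (by positivity) ENNReal.coe_ne_top _).trans ?_
  rw [ENNReal.coe_mul (6 ^ (n * m) * C), mul_assoc]
  gcongr
  exact MixedWeak.weakNorm_iSup_prod_le hm fun c i => (hK c _).trans_eq (by rw [hint])

theorem mainTheorem2 {n m : ℕ} (hn : 0 < n) (hm : 0 < m)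
    (w : Fin m → (Fin n → ℝ) → ℝ≥0∞) (v : (Fin n → ℝ) → ℝ≥0∞)
    (hw : MixedWeak.MemAOneVec w) (hv : MixedWeak.IsWeight v)
    (hnuv : MixedWeak.MemAInfty (fun x => MixedWeak.nu w x * v x ^ (1 / (m : ℝ)))) :
    ∃ C : ℝ≥0, ∀ f : Fin m → (Fin n → ℝ) → ℂ, (∀ i, AEMeasurable (f i) volume) →
      MixedWeak.weakNorm (1 / (m : ℝ))
          (volume.withDensity (fun x => MixedWeak.nu w x * v x ^ (1 / (m : ℝ))))
          (fun x => MixedWeak.multiMaximal f x / v x) ≤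
        C * ∏ i, ∫⁻ x, ‖f i x‖ₑ * w i x := by
  obtain ⟨C, hC⟩ := mainTheorem2_general hm w v hw hnuv
  exact ⟨C, fun f _ => hC fun i y => ‖f i y‖ₑ⟩
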